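/- Notation and definitions. Let $(\mathcal M,\rho)$ be a metric space; write $XY=\rho(X,Y)$. A shortest joining $X$ to $Y$ is a curve from $X$ to $Y$ of length $XY$; $\mathcal M$ is geodesically connected if any two of its points can be joined by a shortest. A triangle in $\mathcal M$ consists of three distinct points and three shortests joining them. For $K\in\mathbb R$ let $\measuredangle_K YXZ$ denote the angle at the vertex corresponding to $X$ of the triangle with side lengths $XY,XZ,YZ$ in the plane of constant curvature $K$. The upper angle between two non-constant shortests with common origin $O$ is $\limsup \measuredangle_K XOY$ as $X$ and $Y$ tend to $O$ along the first and the second shortest, respectively, with $X,Y\ne O$. The $K$-excess of a triangle is the sum of its three upper angles minus the sum of the three angles $\measuredangle_K$ at its vertices. The space $\mathcal M$ is an $\Re_K$ domain (a $\mathrm{CAT}(K)$ space) if it is geodesically connected, the perimeter of every triangle is less than $2\pi/\sqrt K$ when $K>0$, and every triangle has non-positive $K$-excess. For $A\ne P$, $B\neq Q$ in $\mathcal M$ put $x=AP$, $y=BQ$, $a=AB$, $b=PQ$, $d=PB$, $f=AQ$ (if $K>0$, assume $x,y,a<\pi/\sqrt K$). For $K>0$ and $\kappa=\sqrt K$ define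 $$\operatorname{cosq}_K(\overrightarrow{AP},\overrightarrow{BQ})=\frac{\cos\kappa b+\cos\kappa x\cos\kappa y}{\sin\kappa x\sin\kappa y}-\frac{(\cos\kappa x+\cos\kappa d)(\cos\kappa y+\cos\kappa f)}{(1+\cos\kappa a)\sin\kappa x\sin\kappa y},$$ and for $K<0$ and $\kappa=\sqrt{-K}$ define $$\operatorname{cosq}_K(\overrightarrow{AP},\overrightarrow{BQ})=\frac{(\cosh\kappa x+\cosh\kappa d)(\cosh\kappa y+\cosh\kappa f)}{(1+\cosh\kappa a)\sinh\kappa x\sinh\kappa y}-\frac{\cosh\kappa b+\cosh\kappa x\cosh\kappa y}{\sinh\kappa x\sinh\kappa y}.$$ Theorem. (1) Let $K\ne0$, and let $A,P,B,Q$ be points of an $\Re_K$ domain such that $A\neq P$, $B\ne Q$ and, if $K>0$, $\operatorname{diam}\{A,P,B,Q\}\le\pi/(2\sqrt K)$. Then $$\left|\operatorname{cosq}_K(\overrightarrow{AP},\overrightarrow{BQ})\right|\le1.$$ (2) For $K>0$ the diameter bound is sharp. Namely, let $K>0$, $0<\varepsilon<\pi/12$ and $l=(\pi/4+\varepsilon)/\sqrt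 K$, and let $\mathcal M_\varepsilon$ be the $T$-shaped graph, with its length metric, obtained by gluing the end $O$ of a segment $AO$ of length $l$ to the midpoint $O$ of a segment $BQ$ of length $2l$. Then $\mathcal M_\varepsilon$ is an $\Re_K$ domain of diameter $(\pi/2+2\varepsilon)/\sqrt K$, and for the point $P$ of $AO$ with $AP=\varepsilon/\sqrt K$, $$\operatorname{cosq}_K(\overrightarrow{BQ},\overrightarrow{AP})=\frac{1+\sin2\varepsilon}{1-\sin2\varepsilon}>1,\qquad \operatorname{cosq}_K(\overrightarrow{BQ},\overrightarrow{PA})=-\frac{(1+\sin2\varepsilon)\cos\varepsilon}{(1-\sin\varepsilon)\cos2\varepsilon}<-1.$$ -/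

import Mathlib

open Set Filter Topology

noncomputable section

/-- The `K`-quadrilateral cosine of the bound vectors `AP` and `BQ`. It is meaningful for `A ≠ P`,
`B ≠ Q` and, if `K > 0`, for `AP`, `BQ`, `AB` smaller than `π / √K`. -/
def cosq {M : Type*} [MetricSpace M] (K : ℝ) (A P B Q : M) : ℝ :=
  let x := dist A P
  let y := dist B Q
  let a := dist A B
  let b := dist P Q
  let d := dist P B
  let f := dist A Q
  if 0 < K then
    let k := √K
    (Real.cos (k * b) + Real.cos (k * x) * Real.cos (k * y)) /
        (Real.sin (k * x) * Real.sin (k * y)) -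
      (Real.cos (k * x) + Real.cos (k * d)) * (Real.cos (k * y) + Real.cos (k * f)) /
        ((1 + Real.cos (k * a)) * Real.sin (k * x) * Real.sin (k * y))
  else if K < 0 then
    let k := √(-K)
    (Real.cosh (k * x) + Real.cosh (k * d)) * (Real.cosh (k * y) + Real.cosh (k * f)) /
        ((1 + Real.cosh (k * a)) * Real.sinh (k * x) * Real.sinh (k * y)) -
      (Real.cosh (k * b) + Real.cosh (k * x) * Real.cosh (k * y)) /
        (Real.sinh (k * x) * Real.sinh (k * y))
  else
    (f ^ 2 + d ^ 2 - a ^ 2 - b ^ 2) / (2 * x * y)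

/-- The angle of a triangle in the `K`-plane (the plane of constant curvature `K`) between the
sides of lengths `x` and `y`, the opposite side having length `z`, as given by the law of cosines
of the `K`-plane. It is meaningful when such a triangle exists and `x`, `y` are positive: `x`, `y`,
`z` satisfy the triangle inequalities and, if `K > 0`, then `x + y + z < 2π / √K`. -/
def modelAngle (K x y z : ℝ) : ℝ :=
  if 0 < K then
    let k := √K
    Real.arccos ((Real.cos (k * z) - Real.cos (k * x) * Real.cos (k * y)) /
      (Real.sin (k * x) * Real.sin (k * y)))
  else if K < 0 then
    let k := √(-K)
    Real.arccos ((Real.cosh (k * x) * Real.cosh (k * y) - Real.cosh (k * z)) /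
      (Real.sinh (k * x) * Real.sinh (k * y)))
  else
    Real.arccos ((x ^ 2 + y ^ 2 - z ^ 2) / (2 * x * y))

/-- `γ`, restricted to `[0, PQ]`, is the arc length parametrization of a shortest joining
`P` to `Q`. The values of `γ` outside this interval play no role. -/
structure IsShortest {M : Type*} [MetricSpace M] (γ : ℝ → M) (P Q : M) : Prop where
  source : γ 0 = P
  target : γ (dist P Q) = Q
  isometry : ∀ s ∈ Icc 0 (dist P Q), ∀ t ∈ Icc 0 (dist P Q), dist (γ s) (γ t) = |s - t|

/-- The same arc, of length `l`, parametrized from its other end. -/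
def reverseArc {M : Type*} (γ : ℝ → M) (l : ℝ) : ℝ → M := fun t => γ (l - t)

/-- The upper angle between two non-constant shortests, parametrized by arc length, with the common
starting point `γ 0 = η 0`: the upper limit of the comparison angles as `x → 0+`, `y → 0+`. -/
def upperAngle {M : Type*} [MetricSpace M] (K : ℝ) (γ η : ℝ → M) : ℝ :=
  limsup (fun p : ℝ × ℝ => modelAngle K p.1 p.2 (dist (γ p.1) (η p.2))) (𝓝[>] 0 ×ˢ 𝓝[>] 0)

/-- A geodesic triangle: three distinct points and three shortests joining them. -/
structure GeodesicTriangle (M : Type*) [MetricSpace M] where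
  A : M
  B : M
  C : M
  AB : ℝ → M
  BC : ℝ → M
  CA : ℝ → M
  ne_AB : A ≠ B
  ne_BC : B ≠ C
  ne_CA : C ≠ A
  shortest_AB : IsShortest AB A B
  shortest_BC : IsShortest BC B C
  shortest_CA : IsShortest CA C A

namespace GeodesicTriangle

variable {M : Type*} [MetricSpace M]

def perimeter (T : GeodesicTriangle M) : ℝ :=
  dist T.A T.B + dist T.B T.C + dist T.C T.A

/-- The sum of the upper angles of the triangle, at `A`, at `B` and at `C`. -/
def upperAngleSum (K : ℝ) (T : GeodesicTriangle M) : ℝ :=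
  upperAngle K T.AB (reverseArc T.CA (dist T.C T.A)) +
  upperAngle K T.BC (reverseArc T.AB (dist T.A T.B)) +
  upperAngle K T.CA (reverseArc T.BC (dist T.B T.C))

/-- The sum of the angles, at `A`, at `B` and at `C`, of the isometric copy of the triangle
in the `K`-plane. -/
def modelAngleSum (K : ℝ) (T : GeodesicTriangle M) : ℝ :=
  modelAngle K (dist T.A T.B) (dist T.C T.A) (dist T.B T.C) +
  modelAngle K (dist T.B T.C) (dist T.A T.B) (dist T.C T.A) +
  modelAngle K (dist T.C T.A) (dist T.B T.C) (dist T.A T.B)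

/-- The (upper) `K`-excess of a triangle. -/
def excess (K : ℝ) (T : GeodesicTriangle M) : ℝ :=
  T.upperAngleSum K - T.modelAngleSum K

end GeodesicTriangle

/-- The metric space `M` is an `ℜ_K` domain (a `CAT(K)` space): it is geodesically connected,
the perimeter of every triangle is less than `2π / √K` if `K > 0`, and every triangle has
non-positive `K`-excess. -/
structure IsReDomain (K : ℝ) (M : Type*) [MetricSpace M] : Prop where
  geodesic : ∀ P Q : M, ∃ γ : ℝ → M, IsShortest γ P Q
  perimeter_lt : 0 < K → ∀ T : GeodesicTriangle M, T.perimeter < 2 * Real.pi / √K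
  excess_nonpos : ∀ T : GeodesicTriangle M, T.excess K ≤ 0

/-- The `T`-shaped graph obtained by gluing an end of a segment of length `l` to the middle of a
segment of length `2 * l`, with its length metric. It is realized in the plane with the `ℓ¹`
metric, as the union of `[-l, l] × {0}` and `{0} × [0, l]`: the `ℓ¹` distance between two points of
this set is the length of the arc of the graph between them. -/
def TGraph (l : ℝ) : Set (PiLp 1 (fun _ : Fin 2 => ℝ)) :=
  {p | (p 0 ∈ Icc (-l) l ∧ p 1 = 0) ∨ (p 0 = 0 ∧ p 1 ∈ Icc 0 l)}

end

/-!
The bound `|cosq| ≤ 1` holds for four points of the `K`-plane, where `cosq` is the inner product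
of the unit vector at `A` towards `P`, parallel transported along `AB`, and the unit vector at `B`
towards `Q`. In an `ℜ_K` domain it follows by comparison. `cosq` increases with the cosines of the
distance `PQ` and decreases with those of the diagonals, so for the upper bound one copies the
triangles `ABP` and `QBP` to the two sides of a segment of the `K`-plane, which cannot but enlarge
the distance `AQ` as long as the copies form a convex quadrilateral; for the lower bound one does
the same with the triangles `ABP` and `ABQ`, and the distance `PQ`. If the quadrilateral is not
convex, its angle at one end of the diagonal is at least `π`, and an inequality that is linear in
the cosine of one distance results from the triangle inequality (`four_points`, `upper_bound`,
`lower_bound`).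

This needs the usual comparison of distances (`stewart_le`), while the definition of an `ℜ_K`
domain bounds only the sum of the three upper angles of a triangle. The passage is
`upperAngle_le_modelAngle`: each upper angle is at most the angle of the copy of the triangle in
the `K`-plane. Assume that the comparison angle at `O` of two shortests, as a function of the
distances `x`, `y` from `O`, is somewhere less than their upper angle, by `D`, say. The excess
inequality then makes another of the upper angles of the triangle smaller than its comparison
angle, by `D / 2` or more, and by the first variation of the distance, the comparison angle at `O`
decreases at a definite rate in the variable `log x` or `log y` as the corresponding vertex moves
towards `O`. As this can be continued indefinitely, the angle would become negative. In the proof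
the descent is replaced by minimizing the angle minus a small multiple of `log x + log y` on a
rectangle.

The cases `K > 0` and `K < 0` are treated together by means of the functions `cs K` and `sn K`,
with `cs K ^ 2 + K * sn K ^ 2 = 1`; inequalities between values of `cs K` are multiplied by `K`,
which turns them around for `K < 0` as they should be.

The graph of the second part has the four-point property of trees. Hence two shortests from a
point coincide in the beginning, and have upper angle zero, unless they are parts of one shortest,
in which case the comparison angle is `π`.
-/

/-! ### The cosine and the sine of the `K`-plane -/

/-- The cosine of the `K`-plane: `cos (√K t)` if `K > 0` and `cosh (√(-K) t)` if `K < 0`. -/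
noncomputable def cs (K t : ℝ) : ℝ := if 0 < K then Real.cos (√K * t) else Real.cosh (√(-K) * t)

/-- The sine of the `K`-plane, normalized to have derivative `1` at `0`. -/
noncomputable def sn (K t : ℝ) : ℝ :=
  if 0 < K then Real.sin (√K * t) / √K else Real.sinh (√(-K) * t) / √(-K)

lemma cs_zero (K : ℝ) : cs K 0 = 1 := by simp [cs]

lemma sn_zero (K : ℝ) : sn K 0 = 0 := by simp [sn]

lemma cs_neg (K t : ℝ) : cs K (-t) = cs K t := by simp [cs]

lemma sn_neg (K t : ℝ) : sn K (-t) = -sn K t := by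
  unfold sn; split_ifs <;> simp [neg_div]

lemma cs_abs (K t : ℝ) : cs K |t| = cs K t := by
  rcases abs_choice t with h | h <;> rw [h]
  exact cs_neg K t

lemma cs_sq {K : ℝ} (hK : K ≠ 0) (t : ℝ) : cs K t ^ 2 + K * sn K t ^ 2 = 1 := by
  unfold cs sn
  split_ifs with h
  · have h1 : √K ^ 2 = K := Real.sq_sqrt h.le
    have h2 : √K ≠ 0 := (Real.sqrt_pos.2 h).ne'
    have := Real.sin_sq_add_cos_sq (√K * t)
    rw [div_pow, h1]; field_simp; linarith
  · have h0 : 0 < -K := by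
      rcases lt_or_gt_of_ne hK with h' | h' <;> [linarith; exact absurd h' h]
    have h1 : √(-K) ^ 2 = -K := Real.sq_sqrt h0.le
    have := Real.cosh_sq (√(-K) * t)
    rw [div_pow, h1]; field_simp; linarith

lemma cs_add {K : ℝ} (hK : K ≠ 0) (u v : ℝ) :
    cs K (u + v) = cs K u * cs K v - K * sn K u * sn K v := by
  unfold cs sn
  split_ifs with h
  · have h1 : √K * √K = K := Real.mul_self_sqrt h.le
    have h2 : √K ≠ 0 := (Real.sqrt_pos.2 h).ne'
    rw [mul_add, Real.cos_add]
    nth_rewrite 7 [← h1]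
    field_simp
  · have h0 : 0 < -K := by
      rcases lt_or_gt_of_ne hK with h' | h' <;> [linarith; exact absurd h' h]
    have h1 : √(-K) * √(-K) = -K := Real.mul_self_sqrt h0.le
    have h2 : √(-K) ≠ 0 := (Real.sqrt_pos.2 h0).ne'
    rw [mul_add, Real.cosh_add]
    have h3 : K = -(√(-K) * √(-K)) := by linarith
    have : K * (Real.sinh (√(-K) * u) / √(-K)) * (Real.sinh (√(-K) * v) / √(-K)) =
      -(Real.sinh (√(-K) * u) * Real.sinh (√(-K) * v)) := by
      calc _ = K * (Real.sinh (√(-K) * u) * Real.sinh (√(-K) * v) / (√(-K) * √(-K))) := by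
            field_simp
        _ = _ := by rw [h1]; field_simp
    rw [this]; ring

lemma sn_add (K u v : ℝ) :
    sn K (u + v) = sn K u * cs K v + cs K u * sn K v := by
  unfold cs sn
  split_ifs with h
  · rw [mul_add, Real.sin_add]; ring
  · rw [mul_add, Real.sinh_add]; ring

lemma cs_sub {K : ℝ} (hK : K ≠ 0) (u v : ℝ) :
    cs K (u - v) = cs K u * cs K v + K * sn K u * sn K v := by
  rw [sub_eq_add_neg, cs_add hK, cs_neg, sn_neg]; ring

lemma sn_sub (K u v : ℝ) :
    sn K (u - v) = sn K u * cs K v - cs K u * sn K v := by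
  rw [sub_eq_add_neg, sn_add, cs_neg, sn_neg]; ring

lemma neg_of_not_pos {K : ℝ} (hK : K ≠ 0) (h : ¬ 0 < K) : K < 0 :=
  lt_of_le_of_ne (not_lt.1 h) hK

lemma hasDerivAt_cs {K : ℝ} (hK : K ≠ 0) (t : ℝ) : HasDerivAt (cs K) (-(K * sn K t)) t := by
  have hl : ∀ k : ℝ, HasDerivAt (fun t => k * t) k t := fun k => by
    simpa using (hasDerivAt_id t).const_mul k
  by_cases h : 0 < K
  · have h1 : √K * √K = K := Real.mul_self_sqrt h.le
    have h2 : √K ≠ 0 := (Real.sqrt_pos.2 h).ne'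
    have : cs K = fun t => Real.cos (√K * t) := by ext; simp [cs, h]
    rw [this]
    convert (hl √K).cos using 1
    simp only [sn, h, if_true]
    nth_rewrite 1 [← h1]
    field_simp
  · have h0 : 0 < -K := by linarith [neg_of_not_pos hK h]
    have h1 : √(-K) * √(-K) = -K := Real.mul_self_sqrt h0.le
    have h2 : √(-K) ≠ 0 := (Real.sqrt_pos.2 h0).ne'
    have : cs K = fun t => Real.cosh (√(-K) * t) := by ext; simp [cs, h]
    rw [this]
    convert (hl √(-K)).cosh using 1
    simp only [sn, h, if_false]
    calc _ = (-K) * (Real.sinh (√(-K) * t) / √(-K)) := by ring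
      _ = (√(-K) * √(-K)) * (Real.sinh (√(-K) * t) / √(-K)) := by rw [h1]
      _ = _ := by field_simp

lemma hasDerivAt_sn {K : ℝ} (hK : K ≠ 0) (t : ℝ) : HasDerivAt (sn K) (cs K t) t := by
  have hl : ∀ k : ℝ, HasDerivAt (fun t => k * t) k t := fun k => by
    simpa using (hasDerivAt_id t).const_mul k
  by_cases h : 0 < K
  · have h2 : √K ≠ 0 := (Real.sqrt_pos.2 h).ne'
    have : sn K = fun t => Real.sin (√K * t) / √K := by ext; simp [sn, h]
    rw [this]
    have hc : cs K t = Real.cos (√K * t) * √K / √K := by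
      rw [cs, if_pos h]; field_simp
    rw [hc]
    exact (hl √K).sin.div_const (√K)
  · have h0 : 0 < -K := by linarith [neg_of_not_pos hK h]
    have h2 : √(-K) ≠ 0 := (Real.sqrt_pos.2 h0).ne'
    have : sn K = fun t => Real.sinh (√(-K) * t) / √(-K) := by ext; simp [sn, h]
    rw [this]
    have hc : cs K t = Real.cosh (√(-K) * t) * √(-K) / √(-K) := by
      rw [cs, if_neg h]; field_simp
    rw [hc]
    exact (hl √(-K)).sinh.div_const (√(-K))

lemma continuous_cs {K : ℝ} (hK : K ≠ 0) : Continuous (cs K) :=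
  continuous_iff_continuousAt.2 fun t => (hasDerivAt_cs hK t).continuousAt

lemma continuous_sn {K : ℝ} (hK : K ≠ 0) : Continuous (sn K) :=
  continuous_iff_continuousAt.2 fun t => (hasDerivAt_sn hK t).continuousAt

lemma sn_pos {K t : ℝ} (hK : K ≠ 0) (ht : 0 < t) (h : 0 < K → √K * t < Real.pi) : 0 < sn K t := by
  unfold sn
  split_ifs with hp
  · have h2 : 0 < √K := Real.sqrt_pos.2 hp
    exact div_pos (Real.sin_pos_of_pos_of_lt_pi (mul_pos h2 ht) (h hp)) h2
  · have h0 : 0 < √(-K) := Real.sqrt_pos.2 (by linarith [neg_of_not_pos hK hp])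
    exact div_pos (Real.sinh_pos_iff.2 (mul_pos h0 ht)) h0

lemma sn_nonneg {K t : ℝ} (hK : K ≠ 0) (ht : 0 ≤ t) (h : 0 < K → √K * t ≤ Real.pi) :
    0 ≤ sn K t := by
  unfold sn
  split_ifs with hp
  · have h2 : 0 < √K := Real.sqrt_pos.2 hp
    exact div_nonneg (Real.sin_nonneg_of_nonneg_of_le_pi (by positivity) (h hp)) h2.le
  · have h0 : 0 < √(-K) := Real.sqrt_pos.2 (by linarith [neg_of_not_pos hK hp])
    exact div_nonneg (Real.sinh_nonneg_iff.2 (by positivity)) h0.le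

lemma one_le_cs {K : ℝ} (h : ¬ 0 < K) (t : ℝ) : 1 ≤ cs K t := by
  simp only [cs, h, if_false]; exact Real.one_le_cosh _

lemma neg_one_le_cs (K t : ℝ) : -1 ≤ cs K t := by
  by_cases h : 0 < K
  · simp only [cs, h, if_true]; exact Real.neg_one_le_cos _
  · linarith [one_le_cs h t]

/-- `cs K` decreases for `K > 0`, up to the diameter of the `K`-plane, and increases for `K < 0`;
the factor `K` unites the two cases. -/
lemma mul_cs_sub_cs_nonneg {K u v : ℝ} (hK : K ≠ 0) (hu : 0 ≤ u) (huv : u ≤ v)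
    (hv : 0 < K → √K * v ≤ Real.pi) : 0 ≤ K * (cs K u - cs K v) := by
  unfold cs
  split_ifs with hp
  · have h2 : 0 < √K := Real.sqrt_pos.2 hp
    have := Real.cos_le_cos_of_nonneg_of_le_pi (by positivity) (hv hp)
      (mul_le_mul_of_nonneg_left huv h2.le)
    nlinarith
  · have hn := neg_of_not_pos hK hp
    have h0 : 0 < √(-K) := Real.sqrt_pos.2 (by linarith)
    have : Real.cosh (√(-K) * u) ≤ Real.cosh (√(-K) * v) := by
      rw [Real.cosh_le_cosh, abs_of_nonneg (by positivity),
        abs_of_nonneg (mul_nonneg h0.le (hu.trans huv))]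
      exact mul_le_mul_of_nonneg_left huv h0.le
    nlinarith

lemma mul_cs_sub_cs_pos {K u v : ℝ} (hK : K ≠ 0) (hu : 0 ≤ u) (huv : u < v)
    (hv : 0 < K → √K * v ≤ Real.pi) : 0 < K * (cs K u - cs K v) := by
  unfold cs
  split_ifs with hp
  · have h2 : 0 < √K := Real.sqrt_pos.2 hp
    have := Real.cos_lt_cos_of_nonneg_of_le_pi (by positivity) (hv hp)
      (mul_lt_mul_of_pos_left huv h2)
    nlinarith
  · have hn := neg_of_not_pos hK hp
    have h0 : 0 < √(-K) := Real.sqrt_pos.2 (by linarith)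
    have : Real.cosh (√(-K) * u) < Real.cosh (√(-K) * v) := by
      rw [Real.cosh_lt_cosh, abs_of_nonneg (by positivity),
        abs_of_nonneg (mul_nonneg h0.le (hu.trans huv.le))]
      exact mul_lt_mul_of_pos_left huv h0
    nlinarith

lemma eq_of_cs_eq {K u v : ℝ} (hK : K ≠ 0) (hu : 0 ≤ u) (hv : 0 ≤ v)
    (hu' : 0 < K → √K * u ≤ Real.pi) (hv' : 0 < K → √K * v ≤ Real.pi)
    (h : cs K u = cs K v) : u = v := by
  rcases lt_trichotomy u v with h1 | h1 | h1
  · have := mul_cs_sub_cs_pos hK hu h1 hv'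
    rw [h] at this; simp at this
  · exact h1
  · have := mul_cs_sub_cs_pos hK hv h1 hu'
    rw [h] at this; simp at this

lemma cs_perimeter {K x y z : ℝ} (hK : K ≠ 0) (hz : 0 ≤ z)
    (hxyz : z ≤ x + y) (hp : 0 < K → √K * (x + y + z) ≤ 2 * Real.pi) :
    0 ≤ K * (cs K z - cs K (x + y)) := by
  by_cases h : 0 < K ∧ Real.pi < √K * (x + y)
  · obtain ⟨h, h'⟩ := h
    have h2 : 0 < √K := Real.sqrt_pos.2 h
    have : Real.cos (√K * (x + y)) ≤ Real.cos (√K * z) := by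
      rw [← Real.cos_two_pi_sub]
      apply Real.cos_le_cos_of_nonneg_of_le_pi (by positivity) (by linarith)
      have := hp h
      rw [mul_add] at this; linarith
    simp only [cs, h, if_true]
    nlinarith
  · push Not at h
    exact mul_cs_sub_cs_nonneg hK hz hxyz h

lemma cs_half {K : ℝ} (hK : K ≠ 0) (t : ℝ) : cs K t = 1 - 2 * K * sn K (t / 2) ^ 2 := by
  have h1 := cs_add hK (t / 2) (t / 2)
  have h2 := cs_sq hK (t / 2)
  rw [add_halves] at h1
  rw [h1]; linear_combination h2

/-! ### Triangles of the `K`-plane -/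

/-- The cosine of the angle between the sides `x` and `y` of a triangle of the `K`-plane with the
third side `z`. -/
noncomputable def angleCos (K x y z : ℝ) : ℝ := (cs K z - cs K x * cs K y) / (K * sn K x * sn K y)

lemma modelAngle_eq {K : ℝ} (hK : K ≠ 0) (x y z : ℝ) :
    modelAngle K x y z = Real.arccos (angleCos K x y z) := by
  unfold modelAngle angleCos cs sn
  by_cases h : 0 < K
  · have h1 : √K * √K = K := Real.mul_self_sqrt h.le
    simp only [h, if_true]
    congr 2
    calc _ = (√K * √K) * (Real.sin (√K * x) / √K) * (Real.sin (√K * y) / √K) := by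
          have h2 : √K ≠ 0 := (Real.sqrt_pos.2 h).ne'
          field_simp
      _ = _ := by rw [h1]
  · have h' := neg_of_not_pos hK h
    have h0 : 0 < -K := by linarith
    have h1 : √(-K) * √(-K) = -K := Real.mul_self_sqrt h0.le
    have h2 : √(-K) ≠ 0 := (Real.sqrt_pos.2 h0).ne'
    simp only [h, h', if_true, if_false]
    rw [← neg_div_neg_eq]
    congr 2
    · ring
    calc _ = -(√(-K) * √(-K)) * (Real.sinh (√(-K) * x) / √(-K)) *
          (Real.sinh (√(-K) * y) / √(-K)) := by field_simp
      _ = _ := by rw [h1]; ring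

lemma angleCos_comm (K x y z : ℝ) : angleCos K x y z = angleCos K y x z := by
  unfold angleCos; congr 1 <;> ring

lemma modelAngle_comm {K : ℝ} (hK : K ≠ 0) (x y z : ℝ) :
    modelAngle K x y z = modelAngle K y x z := by
  rw [modelAngle_eq hK, modelAngle_eq hK, angleCos_comm]

lemma modelAngle_nonneg {K : ℝ} (hK : K ≠ 0) (x y z : ℝ) : 0 ≤ modelAngle K x y z := by
  rw [modelAngle_eq hK]; exact Real.arccos_nonneg _

lemma modelAngle_le_pi {K : ℝ} (hK : K ≠ 0) (x y z : ℝ) : modelAngle K x y z ≤ Real.pi := by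
  rw [modelAngle_eq hK]; exact Real.arccos_le_pi _

/-- The law of cosines. -/
lemma mul_angleCos {K x y : ℝ} (hK : K ≠ 0) (hx : sn K x ≠ 0) (hy : sn K y ≠ 0) (z : ℝ) :
    K * sn K x * sn K y * angleCos K x y z = cs K z - cs K x * cs K y := by
  unfold angleCos; field_simp

lemma le_angleCos_iff {K x y : ℝ} (hK : K ≠ 0) (hx : 0 < sn K x) (hy : 0 < sn K y) (z c : ℝ) :
    c ≤ angleCos K x y z ↔ 0 ≤ K * (cs K z - cs K x * cs K y - K * sn K x * sn K y * c) := by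
  have h : K * (cs K z - cs K x * cs K y - K * sn K x * sn K y * c) =
      (K ^ 2 * sn K x * sn K y) * (angleCos K x y z - c) := by
    rw [← mul_angleCos hK hx.ne' hy.ne' z]; ring
  have : 0 < K ^ 2 * sn K x * sn K y := by positivity
  rw [h, mul_nonneg_iff_of_pos_left this, sub_nonneg]

lemma angleCos_le_iff {K x y : ℝ} (hK : K ≠ 0) (hx : 0 < sn K x) (hy : 0 < sn K y) (z c : ℝ) :
    angleCos K x y z ≤ c ↔ 0 ≤ K * (cs K x * cs K y + K * sn K x * sn K y * c - cs K z) := by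
  have h : K * (cs K x * cs K y + K * sn K x * sn K y * c - cs K z) =
      (K ^ 2 * sn K x * sn K y) * (c - angleCos K x y z) := by
    have := mul_angleCos hK hx.ne' hy.ne' z
    linear_combination K * this
  have : 0 < K ^ 2 * sn K x * sn K y := by positivity
  rw [h, mul_nonneg_iff_of_pos_left this, sub_nonneg]

lemma angleCos_anti {K x y z w : ℝ} (hK : K ≠ 0) (hx : 0 < sn K x) (hy : 0 < sn K y)
    (hz : 0 ≤ z) (hzw : z ≤ w) (hw : 0 < K → √K * w ≤ Real.pi) :
    angleCos K x y w ≤ angleCos K x y z := by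
  rw [le_angleCos_iff hK hx hy]
  have := mul_cs_sub_cs_nonneg hK hz hzw hw
  rw [mul_angleCos hK hx.ne' hy.ne' w]
  linarith

/-- Three numbers satisfying the triangle inequalities, of sum at most `2π / √K` if `K > 0`, are the
sides of a triangle of the `K`-plane. -/
lemma angleCos_mem {K x y z : ℝ} (hK : K ≠ 0) (hx : 0 < x) (hy : 0 < y)
    (hx' : 0 < K → √K * x < Real.pi) (hy' : 0 < K → √K * y < Real.pi)
    (hz' : 0 < K → √K * z ≤ Real.pi)
    (h1 : |x - y| ≤ z) (h2 : z ≤ x + y) (hp : 0 < K → √K * (x + y + z) ≤ 2 * Real.pi) :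
    angleCos K x y z ∈ Icc (-1) 1 := by
  have hsx := sn_pos hK hx hx'
  have hsy := sn_pos hK hy hy'
  constructor
  · rw [le_angleCos_iff hK hsx hsy]
    have := cs_perimeter hK ((abs_nonneg _).trans h1) h2 hp
    rw [cs_add hK] at this
    linarith
  · rw [angleCos_le_iff hK hsx hsy]
    have := mul_cs_sub_cs_nonneg hK (abs_nonneg _) h1 hz'
    rw [cs_abs, cs_sub hK] at this
    linarith

lemma angleCos_sub {K x y : ℝ} (hK : K ≠ 0) (hx : sn K x ≠ 0) (hy : sn K y ≠ 0) :
    angleCos K x y |x - y| = 1 := by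
  rw [angleCos, cs_abs, cs_sub hK]; field_simp; ring

lemma angleCos_add {K x y : ℝ} (hK : K ≠ 0) (hx : sn K x ≠ 0) (hy : sn K y ≠ 0) :
    angleCos K x y (x + y) = -1 := by
  rw [angleCos, cs_add hK]; field_simp; ring

/-- Squaring the law of sines: the sines of two angles are proportional to the opposite sides. -/
lemma sine_rule {K x y z : ℝ} (hK : K ≠ 0) (hx : sn K x ≠ 0) (hy : sn K y ≠ 0) (hz : sn K z ≠ 0) :
    sn K y ^ 2 * (1 - angleCos K x y z ^ 2) = sn K z ^ 2 * (1 - angleCos K x z y ^ 2) := by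
  have h1 := mul_angleCos hK hx hy z
  have h2 := mul_angleCos hK hx hz y
  have e1 := cs_sq hK x
  have e2 := cs_sq hK y
  have e3 := cs_sq hK z
  have h : (K ^ 2 * sn K x ^ 2) * (sn K y ^ 2 * (1 - angleCos K x y z ^ 2)) =
      (K ^ 2 * sn K x ^ 2) * (sn K z ^ 2 * (1 - angleCos K x z y ^ 2)) := by
    calc _ = (K * sn K x ^ 2) * (K * sn K y ^ 2) - (K * sn K x * sn K y * angleCos K x y z) ^ 2 := by
          ring
      _ = (K * sn K x ^ 2) * (K * sn K z ^ 2) - (K * sn K x * sn K z * angleCos K x z y) ^ 2 := by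
          rw [h1, h2]
          have a1 : K * sn K x ^ 2 = 1 - cs K x ^ 2 := by linarith
          have a2 : K * sn K y ^ 2 = 1 - cs K y ^ 2 := by linarith
          have a3 : K * sn K z ^ 2 = 1 - cs K z ^ 2 := by linarith
          rw [a1, a2, a3]; ring
      _ = _ := by ring
  exact mul_left_cancel₀ (by positivity) h

/-! ### Shortests -/

namespace IsShortest

variable {M : Type*} [MetricSpace M] {γ : ℝ → M} {P Q : M}

lemma dist_left (h : IsShortest γ P Q) {t : ℝ} (ht : t ∈ Icc 0 (dist P Q)) :
    dist P (γ t) = t := by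
  have := h.isometry 0 ⟨le_rfl, dist_nonneg⟩ t ht
  rw [h.source, zero_sub, abs_neg, abs_of_nonneg ht.1] at this
  exact this

lemma dist_right (h : IsShortest γ P Q) {t : ℝ} (ht : t ∈ Icc 0 (dist P Q)) :
    dist (γ t) Q = dist P Q - t := by
  have := h.isometry t ht _ ⟨dist_nonneg, le_rfl⟩
  rw [h.target, abs_sub_comm, abs_of_nonneg (by linarith [ht.2])] at this
  exact this

lemma initial (h : IsShortest γ P Q) {t : ℝ} (ht : t ∈ Icc 0 (dist P Q)) :
    IsShortest γ P (γ t) where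
  source := h.source
  target := by rw [h.dist_left ht]
  isometry := by
    rw [h.dist_left ht]
    exact fun s hs u hu => h.isometry s ⟨hs.1, hs.2.trans ht.2⟩ u ⟨hu.1, hu.2.trans ht.2⟩

lemma final (h : IsShortest γ P Q) {t : ℝ} (ht : t ∈ Icc 0 (dist P Q)) :
    IsShortest (fun s => γ (t + s)) (γ t) Q where
  source := by simp
  target := by rw [h.dist_right ht, add_sub_cancel, h.target]
  isometry := by
    rw [h.dist_right ht]
    intro s hs u hu
    rw [h.isometry _ ⟨by linarith [ht.1, hs.1], by linarith [hs.2]⟩ _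
      ⟨by linarith [ht.1, hu.1], by linarith [hu.2]⟩]
    congr 1; ring

lemma reverse (h : IsShortest γ P Q) : IsShortest (reverseArc γ (dist P Q)) Q P where
  source := by simp [reverseArc, h.target]
  target := by simp [reverseArc, dist_comm Q P, h.source]
  isometry := by
    rw [dist_comm Q P]
    intro s hs u hu
    rw [reverseArc, reverseArc, h.isometry _ ⟨by linarith [hs.2], by linarith [hs.1]⟩ _
      ⟨by linarith [hu.2], by linarith [hu.1]⟩, abs_sub_comm]
    congr 1; ring

lemma continuousOn (h : IsShortest γ P Q) : ContinuousOn γ (Icc 0 (dist P Q)) := by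
  refine (LipschitzOnWith.of_dist_le_mul (K := 1) fun s hs t ht => ?_).continuousOn
  rw [h.isometry s hs t ht, Real.dist_eq, NNReal.coe_one, one_mul]

end IsShortest

lemma reverseArc_reverseArc {M : Type*} (γ : ℝ → M) (l : ℝ) :
    reverseArc (reverseArc γ l) l = γ := by
  funext t; simp [reverseArc]

/-! ### Upper angles -/

section UpperAngle

variable {M : Type*} [MetricSpace M] {K : ℝ} {γ η : ℝ → M}

lemma eventually_modelAngle_lt (hK : K ≠ 0) {α : ℝ} (h : upperAngle K γ η < α) :
    ∀ᶠ p : ℝ × ℝ in 𝓝[>] 0 ×ˢ 𝓝[>] 0, modelAngle K p.1 p.2 (dist (γ p.1) (η p.2)) < α :=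
  eventually_lt_of_limsup_lt h
    (isBoundedUnder_of_eventually_le (.of_forall fun _ => modelAngle_le_pi hK _ _ _))

lemma upperAngle_nonneg (hK : K ≠ 0) (γ η : ℝ → M) : 0 ≤ upperAngle K γ η :=
  le_limsup_of_frequently_le (Frequently.of_forall fun _ => modelAngle_nonneg hK _ _ _)
    (isBoundedUnder_of_eventually_le (.of_forall fun _ => modelAngle_le_pi hK _ _ _))

lemma upperAngle_le_of_eventually_le (hK : K ≠ 0) {α : ℝ}
    (h : ∀ᶠ p : ℝ × ℝ in 𝓝[>] 0 ×ˢ 𝓝[>] 0, modelAngle K p.1 p.2 (dist (γ p.1) (η p.2)) ≤ α) :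
    upperAngle K γ η ≤ α :=
  limsup_le_of_le (IsBoundedUnder.isCoboundedUnder_le
    (isBoundedUnder_of_eventually_ge (.of_forall fun _ => modelAngle_nonneg hK _ _ _))) h

lemma upperAngle_le_pi (hK : K ≠ 0) (γ η : ℝ → M) : upperAngle K γ η ≤ Real.pi :=
  upperAngle_le_of_eventually_le hK (.of_forall fun _ => modelAngle_le_pi hK _ _ _)

lemma upperAngle_comm (hK : K ≠ 0) (γ η : ℝ → M) : upperAngle K γ η = upperAngle K η γ := by
  unfold upperAngle
  conv_lhs => rw [prod_comm]
  simp only [limsup, map_map]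
  congr 2
  funext p
  simp only [Function.comp, Prod.swap]
  rw [modelAngle_comm hK, dist_comm]

lemma tendsto_sn_mul_div (hK : K ≠ 0) (a : ℝ) :
    Tendsto (fun s => sn K (a * s) / s) (𝓝[>] 0) (𝓝 a) := by
  have h1 : HasDerivAt (fun s => sn K (a * s)) a 0 := by
    have hl : HasDerivAt (fun s : ℝ => a * s) a 0 := by
      simpa using (hasDerivAt_id (0 : ℝ)).const_mul a
    have h2 := (hasDerivAt_sn hK (a * 0)).comp (0 : ℝ) hl
    rwa [mul_zero, cs_zero, one_mul] at h2
  have := (hasDerivAt_iff_tendsto_slope_zero.1 h1).mono_left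
    (nhdsWithin_mono _ (fun x (hx : 0 < x) => hx.ne'))
  refine this.congr fun s => ?_
  simp [sn_zero, div_eq_inv_mul]

/-- Infinitesimal triangles of the `K`-plane are Euclidean. -/
lemma tendsto_angleCos (hK : K ≠ 0) {l m : ℝ} (hl : 0 < l) :
    Tendsto (fun s => angleCos K s (l * s) (m * s)) (𝓝[>] 0)
      (𝓝 ((1 + l ^ 2 - m ^ 2) / (2 * l))) := by
  have t1 := tendsto_sn_mul_div hK 1
  have tl := tendsto_sn_mul_div hK l
  have h1 := tendsto_sn_mul_div hK (1 / 2)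
  have h2 := tendsto_sn_mul_div hK (l / 2)
  have h3 := tendsto_sn_mul_div hK (m / 2)
  have h4 : Tendsto (fun s => sn K (l / 2 * s)) (𝓝[>] 0) (𝓝 0) := by
    have : Tendsto (fun s => sn K (l / 2 * s)) (𝓝 0) (𝓝 (sn K (l / 2 * 0))) :=
      ((continuous_sn hK).comp (continuous_const.mul continuous_id)).tendsto 0
    rw [mul_zero, sn_zero] at this
    exact this.mono_left nhdsWithin_le_nhds
  have key := ((((h1.pow 2).const_mul 2).add ((h2.pow 2).const_mul 2)).sub
    ((h3.pow 2).const_mul 2)).sub (((h1.pow 2).mul (h4.pow 2)).const_mul (4 * K))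
  have key2 := key.div (t1.mul tl) (by simpa using hl.ne')
  have e : (2 * (1 / 2) ^ 2 + 2 * (l / 2) ^ 2 - 2 * (m / 2) ^ 2 -
      4 * K * ((1 / 2) ^ 2 * 0 ^ 2)) / (1 * l) = (1 + l ^ 2 - m ^ 2) / (2 * l) := by
    field_simp; ring
  rw [e] at key2
  refine key2.congr' ?_
  filter_upwards [self_mem_nhdsWithin] with s (hs : 0 < s)
  have a1 : 1 / 2 * s = s / 2 := by ring
  have a2 : l / 2 * s = l * s / 2 := by ring
  have a3 : m / 2 * s = m * s / 2 := by ring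
  simp only [Pi.div_apply]
  rw [angleCos, cs_half hK s, cs_half hK (l * s), cs_half hK (m * s), a1, a2, a3, one_mul]
  rcases eq_or_ne (sn K s) 0 with h0 | h0
  · simp [h0]
  rcases eq_or_ne (sn K (l * s)) 0 with h0' | h0'
  · simp [h0']
  field_simp
  ring

/-- Let `c` be less than the cosine of the upper angle between `γ` and `η`. If a point of `η` is much
closer to the common origin than one of `γ`, and both are close to it, then their distance is bounded
as in a Euclidean angle of cosine `c`, where it is `(1 - c * l) * s` up to terms of order `l ^ 2`. -/
lemma eventually_dist_le (hK : K ≠ 0) (hM : ∀ P Q : M, 0 < K → √K * dist P Q ≤ Real.pi) {c : ℝ}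
    (hc : -1 ≤ c) (h : c < Real.cos (upperAngle K γ η)) :
    ∀ᶠ l : ℝ in 𝓝[>] 0, ∀ᶠ s : ℝ in 𝓝[>] 0, dist (γ s) (η (l * s)) ≤ (1 - c * l) * s := by
  obtain ⟨c', hcc', hc'⟩ := exists_between h
  have hc1 : c < 1 := h.trans_le (Real.cos_le_one _)
  have hω : upperAngle K γ η < Real.arccos c' := by
    rw [← Real.arccos_cos (upperAngle_nonneg hK γ η) (upperAngle_le_pi hK γ η)]
    exact Real.arccos_lt_arccos (by linarith) hc' (Real.cos_le_one _)
  have hev := eventually_modelAngle_lt hK hω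
  have hl1 : ∀ᶠ l : ℝ in 𝓝[>] 0, c + l * (1 - c ^ 2) / 2 < c' := by
    have : Tendsto (fun l : ℝ => c + l * (1 - c ^ 2) / 2) (𝓝 0) (𝓝 (c + 0 * (1 - c ^ 2) / 2)) :=
      (Continuous.tendsto (by fun_prop) 0)
    exact (this.mono_left nhdsWithin_le_nhds).eventually_lt_const (by simpa using hcc')
  have hl2 : ∀ᶠ l : ℝ in 𝓝[>] 0, l < 1 := nhdsWithin_le_nhds (eventually_lt_nhds zero_lt_one)
  filter_upwards [hl1, hl2, self_mem_nhdsWithin] with l hl1 hl2 (hl : 0 < l)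
  have hm : 0 < 1 - c * l := by nlinarith
  have ht : Tendsto (fun s : ℝ => l * s) (𝓝[>] 0) (𝓝[>] 0) := by
    refine tendsto_nhdsWithin_iff.2 ⟨?_, ?_⟩
    · have : Tendsto (fun s : ℝ => l * s) (𝓝 0) (𝓝 (l * 0)) := Continuous.tendsto (by fun_prop) 0
      rw [mul_zero] at this
      exact this.mono_left nhdsWithin_le_nhds
    · filter_upwards [self_mem_nhdsWithin] with s (hs : 0 < s) using mul_pos hl hs
  have hlim := tendsto_angleCos hK (m := 1 - c * l) hl
  have e : (1 + l ^ 2 - (1 - c * l) ^ 2) / (2 * l) = c + l * (1 - c ^ 2) / 2 := by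
    field_simp; ring
  rw [e] at hlim
  have hsn : ∀ᶠ s : ℝ in 𝓝[>] 0, 0 < sn K s := by
    have := (tendsto_sn_mul_div hK 1).eventually_const_lt (zero_lt_one)
    filter_upwards [this, self_mem_nhdsWithin] with s h1 (hs : 0 < s)
    rw [one_mul] at h1
    exact (div_pos_iff_of_pos_right hs).1 h1
  filter_upwards [(tendsto_id.prodMk ht).eventually hev, hlim.eventually_lt_const hl1, hsn,
    ht.eventually hsn, self_mem_nhdsWithin] with s h1 h2 h3 h4 (hs : 0 < s)
  by_contra! hlt
  have h5 := angleCos_anti hK h3 h4 (by positivity) hlt.le (hM _ _)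
  simp only [id] at h1
  rw [modelAngle_eq hK] at h1
  exact absurd h1 (not_lt.2 (Real.arccos_le_arccos (h5.trans h2.le)))

/-- First variation of the distance. -/
lemma first_variation (hK : K ≠ 0) (hM : ∀ P Q : M, 0 < K → √K * dist P Q ≤ Real.pi) {X Y : M}
    (hγ : IsShortest γ X Y) (hXY : X ≠ Y) {c : ℝ} (hc : -1 ≤ c)
    (h : c < Real.cos (upperAngle K γ η)) :
    ∀ᶠ s : ℝ in 𝓝[>] 0, dist (η s) Y ≤ dist X Y - c * s := by
  obtain ⟨l, hl, hl0⟩ := ((eventually_dist_le hK hM hc h).and self_mem_nhdsWithin).exists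
  replace hl0 : 0 < l := hl0
  have ht : Tendsto (fun s : ℝ => s / l) (𝓝[>] 0) (𝓝[>] 0) := by
    refine tendsto_nhdsWithin_iff.2 ⟨?_, ?_⟩
    · have : Tendsto (fun s : ℝ => s / l) (𝓝 0) (𝓝 (0 / l)) := Continuous.tendsto (by fun_prop) 0
      rw [zero_div] at this
      exact this.mono_left nhdsWithin_le_nhds
    · filter_upwards [self_mem_nhdsWithin] with s (hs : 0 < s) using div_pos hs hl0
  have hd : ∀ᶠ s : ℝ in 𝓝[>] 0, s < dist X Y :=
    nhdsWithin_le_nhds (eventually_lt_nhds (dist_pos.2 hXY))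
  filter_upwards [ht.eventually hl, ht.eventually hd, self_mem_nhdsWithin] with s h1 h2 (hs : 0 < s)
  rw [mul_div_cancel₀ s hl0.ne'] at h1
  have h3 := hγ.dist_right (t := s / l) ⟨by positivity, h2.le⟩
  have h4 := dist_triangle (η s) (γ (s / l)) Y
  rw [dist_comm (η s) (γ (s / l)), h3] at h4
  have h5 : (1 - c * l) * (s / l) = s / l - c * s := by field_simp
  linarith

/-- The upper angles that a shortest forms with the two directions of a shortest through its
starting point add up to at least `π`. -/
lemma pi_le_upperAngle_add (hK : K ≠ 0) (hM : ∀ P Q : M, 0 < K → √K * dist P Q ≤ Real.pi)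
    {ξ : ℝ → M} (h : ∀ᶠ s in 𝓝[>] 0, dist (γ s) (η s) = 2 * s) :
    Real.pi ≤ upperAngle K γ ξ + upperAngle K η ξ := by
  by_contra! hlt
  have n1 := upperAngle_nonneg hK γ ξ
  have n2 := upperAngle_nonneg hK η ξ
  set ω₁ := upperAngle K γ ξ with hω₁
  set ω₂ := upperAngle K η ξ with hω₂
  have c1 : -1 < Real.cos ω₁ := by
    rw [← Real.cos_pi]; exact Real.cos_lt_cos_of_nonneg_of_le_pi n1 le_rfl (by linarith)
  have c2 : -1 < Real.cos ω₂ := by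
    rw [← Real.cos_pi]; exact Real.cos_lt_cos_of_nonneg_of_le_pi n2 le_rfl (by linarith)
  have hδ : 0 < Real.cos ω₁ + Real.cos ω₂ := by
    have := Real.cos_lt_cos_of_nonneg_of_le_pi n1 (by linarith) (by linarith : ω₁ < Real.pi - ω₂)
    rw [Real.cos_pi_sub] at this; linarith
  set δ := Real.cos ω₁ + Real.cos ω₂ with hδ'
  have e1 := eventually_dist_le hK hM (c := max (-1) (Real.cos ω₁ - δ / 3)) (le_max_left _ _)
    (max_lt c1 (by linarith) : _ < Real.cos (upperAngle K γ ξ))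
  have e2 := eventually_dist_le hK hM (c := max (-1) (Real.cos ω₂ - δ / 3)) (le_max_left _ _)
    (max_lt c2 (by linarith) : _ < Real.cos (upperAngle K η ξ))
  obtain ⟨l, ⟨hl1, hl2⟩, hl⟩ := ((e1.and e2).and self_mem_nhdsWithin).exists
  obtain ⟨s, ⟨⟨h1, h2⟩, h3⟩, hs⟩ := (((hl1.and hl2).and h).and self_mem_nhdsWithin).exists
  replace hl : 0 < l := hl
  replace hs : 0 < s := hs
  have h4 := dist_triangle (γ s) (ξ (l * s)) (η s)
  rw [dist_comm (ξ _), h3] at h4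
  have m1 := le_max_right (-1) (Real.cos ω₁ - δ / 3)
  have m2 := le_max_right (-1) (Real.cos ω₂ - δ / 3)
  have hls : 0 < l * s := mul_pos hl hs
  nlinarith

end UpperAngle

/-! ### Comparison of angles -/

section Hinge

variable {M : Type*} [MetricSpace M] {K : ℝ}

lemma IsReDomain.mul_dist_lt_pi (hM : IsReDomain K M) (P Q : M) (hK : 0 < K) :
    √K * dist P Q < Real.pi := by
  rcases eq_or_ne P Q with rfl | hPQ
  · simpa using Real.pi_pos
  have hk : 0 < √K := Real.sqrt_pos.2 hK
  obtain ⟨γ, hγ⟩ := hM.geodesic P Q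
  have hd := dist_pos.2 hPQ
  have hm : dist P Q / 2 ∈ Icc 0 (dist P Q) := ⟨by linarith, by linarith⟩
  have h1 := hγ.dist_left hm
  have h2 := hγ.dist_right hm
  have := hM.perimeter_lt hK
    { A := P, B := γ (dist P Q / 2), C := Q
      AB := γ, BC := _, CA := _
      ne_AB := dist_pos.1 (by rw [h1]; linarith)
      ne_BC := dist_pos.1 (by rw [h2]; linarith)
      ne_CA := hPQ.symm
      shortest_AB := hγ.initial hm
      shortest_BC := hγ.final hm
      shortest_CA := hγ.reverse }
  simp only [GeodesicTriangle.perimeter] at this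
  rw [h1, h2, dist_comm Q P, lt_div_iff₀ hk] at this
  linarith

lemma IsReDomain.mul_perimeter_lt (hM : IsReDomain K M) (P Q R : M) (hK : 0 < K) :
    √K * (dist P Q + dist P R + dist Q R) < 2 * Real.pi := by
  have hk : 0 < √K := Real.sqrt_pos.2 hK
  have h1 := hM.mul_dist_lt_pi P Q hK
  have h2 := hM.mul_dist_lt_pi P R hK
  by_cases hPQ : P = Q
  · subst hPQ; rw [dist_self]; linarith
  by_cases hPR : P = R
  · subst hPR; rw [dist_self, dist_comm Q P]; linarith
  by_cases hQR : Q = R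
  · subst hQR; rw [dist_self]; linarith
  obtain ⟨γ, hγ⟩ := hM.geodesic P Q
  obtain ⟨η, hη⟩ := hM.geodesic Q R
  obtain ⟨ζ, hζ⟩ := hM.geodesic R P
  have := hM.perimeter_lt hK ⟨P, Q, R, γ, η, ζ, hPQ, hQR, Ne.symm hPR, hγ, hη, hζ⟩
  simp only [GeodesicTriangle.perimeter] at this
  rw [dist_comm R P, lt_div_iff₀ hk] at this
  linarith

lemma IsReDomain.mul_dist_le_pi (hM : IsReDomain K M) (P Q : M) (hK : 0 < K) :
    √K * dist P Q ≤ Real.pi := (hM.mul_dist_lt_pi P Q hK).le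

lemma IsReDomain.sn_dist_pos (hM : IsReDomain K M) (hK : K ≠ 0) {P Q : M} (h : P ≠ Q) :
    0 < sn K (dist P Q) := sn_pos hK (dist_pos.2 h) (hM.mul_dist_lt_pi P Q)

lemma IsReDomain.angleCos_mem (hM : IsReDomain K M) (hK : K ≠ 0) {O X Y : M} (hX : O ≠ X)
    (hY : O ≠ Y) : angleCos K (dist O X) (dist O Y) (dist X Y) ∈ Icc (-1) 1 := by
  refine _root_.angleCos_mem hK (dist_pos.2 hX) (dist_pos.2 hY) (hM.mul_dist_lt_pi _ _)
    (hM.mul_dist_lt_pi _ _) (hM.mul_dist_le_pi _ _) ?_ ?_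
    fun h => (hM.mul_perimeter_lt _ _ _ h).le
  · have := abs_dist_sub_le X Y O
    rwa [dist_comm X O, dist_comm Y O] at this
  · have := dist_triangle X O Y
    rwa [dist_comm X O] at this

/-- The excess inequality, with the sides of the triangle oriented as two shortests from a
vertex `O` and the opposite side. -/
lemma IsReDomain.angle_sum_le (hM : IsReDomain K M) {O X Y : M} {γ η ζ : ℝ → M}
    (hγ : IsShortest γ O X) (hη : IsShortest η O Y) (hζ : IsShortest ζ X Y)
    (hX : O ≠ X) (hY : O ≠ Y) (hXY : X ≠ Y) :
    upperAngle K γ η + upperAngle K ζ (reverseArc γ (dist O X)) +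
        upperAngle K (reverseArc η (dist O Y)) (reverseArc ζ (dist X Y)) ≤
      modelAngle K (dist O X) (dist O Y) (dist X Y) +
        modelAngle K (dist X Y) (dist O X) (dist O Y) +
        modelAngle K (dist O Y) (dist X Y) (dist O X) := by
  have := hM.excess_nonpos ⟨O, X, Y, γ, ζ, _, hX, hXY, hY.symm, hγ, hζ, hη.reverse⟩
  simp only [GeodesicTriangle.excess, GeodesicTriangle.upperAngleSum,
    GeodesicTriangle.modelAngleSum] at this
  rw [dist_comm Y O, reverseArc_reverseArc] at this
  linarith

/-- Move the vertex `X` of a triangle `OXY` of the `K`-plane towards `O`, and let the opposite side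
`XY` decrease at the rate `angleCos K x z y + e`, faster than it does in the `K`-plane. Then the
angle at `O` decreases at a rate at least `e / sn K x`. -/
lemma exists_hasDerivAt_modelAngle (hK : K ≠ 0) {x y z e : ℝ} (hx : 0 < sn K x) (hy : 0 < sn K y)
    (hz : 0 < sn K z) (h1 : -1 < angleCos K x y z) (h2 : angleCos K x y z < 1) (he : 0 < e) :
    ∃ D, HasDerivAt (fun h => modelAngle K (x - h) y (z - (angleCos K x z y + e) * h)) D 0 ∧
      D ≤ -(e / sn K x) := by
  set q := angleCos K x z y with hq
  set E := angleCos K x y z with hE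
  have hx1 : HasDerivAt (fun h => x - h) (-1) 0 := by
    simpa using (hasDerivAt_id (0 : ℝ)).const_sub x
  have hz1 : HasDerivAt (fun h => z - (q + e) * h) (-(q + e)) 0 := by
    simpa using ((hasDerivAt_id (0 : ℝ)).const_mul (q + e)).const_sub z
  have d1 : HasDerivAt (fun h => cs K (z - (q + e) * h)) (K * sn K z * (q + e)) 0 := by
    have := (hasDerivAt_cs hK (z - (q + e) * 0)).comp (0 : ℝ) hz1
    exact this.congr_deriv (by rw [mul_zero, sub_zero]; ring)
  have d2 : HasDerivAt (fun h => cs K (x - h)) (K * sn K x) 0 := by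
    have := (hasDerivAt_cs hK (x - 0)).comp (0 : ℝ) hx1
    exact this.congr_deriv (by simp)
  have d3 : HasDerivAt (fun h => sn K (x - h)) (-cs K x) 0 := by
    have := (hasDerivAt_sn hK (x - 0)).comp (0 : ℝ) hx1
    exact this.congr_deriv (by simp)
  have d4 := (d1.sub (d2.mul_const (cs K y))).div ((d3.const_mul K).mul_const (sn K y))
    (by simpa using ⟨⟨hK, hx.ne'⟩, hy.ne'⟩)
  have hEz : K * sn K x * sn K y * E = cs K z - cs K x * cs K y := mul_angleCos hK hx.ne' hy.ne' z
  have hqy : K * sn K x * sn K z * q = cs K y - cs K x * cs K z := mul_angleCos hK hx.ne' hz.ne' y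
  have d5 : HasDerivAt (fun h => angleCos K (x - h) y (z - (q + e) * h))
      (e * sn K z / (sn K x * sn K y)) 0 := by
    refine d4.congr_deriv ?_
    simp only [Pi.sub_apply, sub_zero, mul_zero]
    rw [eq_comm, div_eq_div_iff (by positivity) (by positivity)]
    have := cs_sq hK x
    linear_combination (-K * sn K x * sn K y ^ 2) * hqy +
      (K * sn K x * sn K y ^ 2) * cs K y * this
  have d6 := (Real.hasDerivAt_arccos (x := angleCos K (x - 0) y (z - (q + e) * 0))
    (by simpa using h1.ne') (by simpa using h2.ne)).comp (0 : ℝ) d5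
  refine ⟨_, d6.congr_of_eventuallyEq (.of_forall fun h => modelAngle_eq hK _ _ _), ?_⟩
  simp only [sub_zero, mul_zero]
  rw [← hE]
  have hpos : 0 < 1 - E ^ 2 := by nlinarith
  have hs : √(1 - E ^ 2) ≤ sn K z / sn K y := by
    rw [Real.sqrt_le_left (by positivity), div_pow, le_div_iff₀ (by positivity)]
    have := sine_rule hK hx.ne' hy.ne' hz.ne'
    rw [← hE, ← hq] at this
    nlinarith [sq_nonneg (sn K z * q)]
  have hs0 : 0 < √(1 - E ^ 2) := Real.sqrt_pos.2 hpos
  rw [le_div_iff₀ hy] at hs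
  have : e / sn K x ≤ 1 / √(1 - E ^ 2) * (e * sn K z / (sn K x * sn K y)) := by
    rw [div_mul_div_comm, div_le_div_iff₀ hx (by positivity)]
    nlinarith [mul_le_mul_of_nonneg_left hs (mul_pos he hx).le]
  linarith

lemma cos_add_le_cos {u v δ : ℝ} (hu : 0 ≤ u) (hδ : 0 < δ) (huv : u + δ ≤ v) (hv : v ≤ Real.pi) :
    Real.cos v + (1 - Real.cos δ) ≤ Real.cos u := by
  have h1 : Real.cos u - Real.cos v = 2 * (Real.sin ((v + u) / 2) * Real.sin ((v - u) / 2)) := by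
    rw [← neg_sub, Real.cos_sub_cos]; ring
  have h2 : 1 - Real.cos δ = 2 * (Real.sin (δ / 2) * Real.sin (δ / 2)) := by
    have := Real.cos_sq' (δ / 2)
    have h3 := Real.cos_two_mul (δ / 2)
    rw [mul_div_cancel₀ _ two_ne_zero] at h3
    linarith [pow_two (Real.sin (δ / 2))]
  have h3 : 0 ≤ Real.sin (δ / 2) := Real.sin_nonneg_of_nonneg_of_le_pi (by linarith) (by linarith)
  have h4 : Real.sin (δ / 2) ≤ Real.sin ((v - u) / 2) :=
    Real.sin_le_sin_of_le_of_le_pi_div_two (by linarith) (by linarith) (by linarith)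
  have h5 : Real.sin (δ / 2) ≤ Real.sin ((v + u) / 2) := by
    rcases le_total ((v + u) / 2) (Real.pi / 2) with h | h
    · exact Real.sin_le_sin_of_le_of_le_pi_div_two (by linarith) h (by linarith)
    · rw [← Real.sin_pi_sub ((v + u) / 2)]
      exact Real.sin_le_sin_of_le_of_le_pi_div_two (by linarith) (by linarith) (by linarith)
  nlinarith [mul_le_mul h5 h4 h3 (h3.trans h5)]

lemma exists_sn_le_mul (hK : K ≠ 0) (m : ℝ) : ∃ C > 0, ∀ x ∈ Icc 0 m, sn K x ≤ C * x := by
  obtain ⟨C, hC⟩ := (isCompact_Icc (a := 0) (b := m)).exists_bound_of_continuousOn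
    (continuous_cs hK).continuousOn
  refine ⟨max C 1, by positivity, fun x hx => ?_⟩
  have := (convex_Icc 0 m).norm_image_sub_le_of_norm_hasDerivWithin_le
    (fun t _ => (hasDerivAt_sn hK t).hasDerivWithinAt) (fun t ht => (hC t ht).trans (le_max_left C 1))
    ⟨le_rfl, hx.1.trans hx.2⟩ hx
  rw [sn_zero, sub_zero, sub_zero, Real.norm_eq_abs, Real.norm_eq_abs, abs_of_nonneg hx.1] at this
  exact (le_abs_self _).trans this

/-- If the upper angle at `γ x` of the triangle with the vertices `O`, `γ x`, `η y` is less than the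
angle of its copy in the `K`-plane, in the sense that its cosine exceeds the other by more than `e`,
then the angle at `O` of the copy decreases as `x` does, faster than `κ log x`. -/
lemma eventually_modelAngle_sub_lt (hK : K ≠ 0) (hM : IsReDomain K M) {O X₀ Y : M} {γ ζ : ℝ → M}
    (hγ : IsShortest γ O X₀) {x : ℝ} (hx0 : 0 < x) (hx : x ≤ dist O X₀) (hY : O ≠ Y)
    (hXY : γ x ≠ Y) (hζ : IsShortest ζ (γ x) Y) {e κ : ℝ} (he : 0 < e) (hκ : κ * sn K x < e * x)
    (h1 : -1 < angleCos K x (dist O Y) (dist (γ x) Y))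
    (h2 : angleCos K x (dist O Y) (dist (γ x) Y) < 1)
    (hang : angleCos K x (dist (γ x) Y) (dist O Y) + e <
      Real.cos (upperAngle K ζ (reverseArc γ x))) :
    ∀ᶠ h in 𝓝[>] 0,
      modelAngle K (x - h) (dist O Y) (dist (γ (x - h)) Y) - κ * Real.log (x - h) <
        modelAngle K x (dist O Y) (dist (γ x) Y) - κ * Real.log x := by
  have hxd := hγ.dist_left ⟨hx0.le, hx⟩
  have hOX : O ≠ γ x := dist_pos.1 (by rw [hxd]; exact hx0)
  have hsx := hM.sn_dist_pos hK hOX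
  rw [hxd] at hsx
  have hsy := hM.sn_dist_pos hK hY
  have hsz := hM.sn_dist_pos hK hXY
  set y := dist O Y
  set z := dist (γ x) Y with hzdef
  set q := angleCos K x z y with hq
  have hqm : -1 ≤ q := by
    have := (hM.angleCos_mem hK hOX.symm hXY).1
    rw [dist_comm (γ x) O, hxd] at this
    exact this
  have hfv := first_variation hK hM.mul_dist_le_pi hζ hXY (by linarith : -1 ≤ q + e) hang
  obtain ⟨D, hD, hDle⟩ := exists_hasDerivAt_modelAngle hK hsx hsy hsz h1 h2 he
  rw [← hq] at hD
  have hlog : HasDerivAt (fun h => κ * Real.log (x - h)) (κ * (-1 / x)) 0 := by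
    have h3 : HasDerivAt (fun h => x - h) (-1) 0 := by
      simpa using (hasDerivAt_id (0 : ℝ)).const_sub x
    have := (h3.log (by simpa using hx0.ne')).const_mul κ
    simpa using this
  have hG := hD.sub hlog
  have hneg : D - κ * (-1 / x) < 0 := by
    have : κ / x < e / sn K x := by rwa [div_lt_div_iff₀ hx0 hsx]
    have h4 : κ * (-1 / x) = -(κ / x) := by ring
    linarith
  have hslope := (hasDerivAt_iff_tendsto_slope_zero.1 hG).mono_left
    (nhdsWithin_mono _ (fun x (hx : 0 < x) => hx.ne'))
  have hsmall : ∀ᶠ h : ℝ in 𝓝[>] 0, h < x := nhdsWithin_le_nhds (eventually_lt_nhds hx0)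
  have hrange : ∀ᶠ h : ℝ in 𝓝[>] 0, 0 < K → √K * (z - (q + e) * h) ≤ Real.pi := by
    by_cases h : 0 < K
    · have ht : Tendsto (fun h : ℝ => √K * (z - (q + e) * h)) (𝓝 0)
          (𝓝 (√K * (z - (q + e) * 0))) := Continuous.tendsto (by fun_prop) 0
      have hlt : √K * (z - (q + e) * 0) < Real.pi := by simpa using hM.mul_dist_lt_pi (γ x) Y h
      filter_upwards [nhdsWithin_le_nhds (ht.eventually_lt_const hlt)] with h h3 _ using h3.le
    · exact .of_forall fun _ h' => absurd h' h
  filter_upwards [hfv, hslope.eventually_lt_const hneg, hsmall, hrange, self_mem_nhdsWithin]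
    with h h3 h4 h5 h6 (h0 : 0 < h)
  have hmem : x - h ∈ Icc 0 (dist O X₀) := ⟨by linarith, by linarith⟩
  have hxd' := hγ.dist_left hmem
  have hOX' : O ≠ γ (x - h) := dist_pos.1 (by rw [hxd']; linarith)
  have hsx' := hM.sn_dist_pos hK hOX'
  rw [hxd'] at hsx'
  rw [reverseArc] at h3
  have h7 : modelAngle K (x - h) y (dist (γ (x - h)) Y) ≤
      modelAngle K (x - h) y (z - (q + e) * h) := by
    rw [modelAngle_eq hK, modelAngle_eq hK]
    exact Real.arccos_le_arccos (angleCos_anti hK hsx' hsy dist_nonneg h3 h6)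
  simp only [zero_add, Pi.sub_apply, sub_zero, mul_zero, smul_eq_mul] at h4
  have h8 := neg_of_mul_neg_right h4 (inv_nonneg.2 h0.le)
  linarith

/-- In an `ℜ_K` domain, shortests making a positive upper angle do not have points at different
distances from the origin whose distance is the difference of these. -/
lemma upperAngle_eq_zero_of_dist_eq (hK : K ≠ 0) (hM : IsReDomain K M) {O X Y : M} {γ η : ℝ → M}
    (hγ : IsShortest γ O X) (hη : IsShortest η O Y) (hX : O ≠ X) (hXY : X ≠ Y)
    (h : dist O Y = dist O X + dist X Y) : upperAngle K γ η = 0 := by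
  have hx := dist_pos.2 hX
  have hz := dist_pos.2 hXY
  have hY : O ≠ Y := dist_pos.1 (by rw [h]; positivity)
  obtain ⟨ζ, hζ⟩ := hM.geodesic X Y
  have hsum := hM.angle_sum_le hγ hη hζ hX hY hXY
  have hsx := hM.sn_dist_pos hK hX
  have hsy := hM.sn_dist_pos hK hY
  have hsz := hM.sn_dist_pos hK hXY
  have e1 : modelAngle K (dist O X) (dist O Y) (dist X Y) = 0 := by
    have : dist X Y = |dist O X - dist O Y| := by
      rw [h, sub_add_cancel_left, abs_neg, abs_of_pos hz]
    rw [modelAngle_eq hK, this, angleCos_sub hK hsx.ne' hsy.ne', Real.arccos_one]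
  have e2 : modelAngle K (dist O Y) (dist X Y) (dist O X) = 0 := by
    have : dist O X = |dist O Y - dist X Y| := by
      rw [h, add_sub_cancel_right, abs_of_pos hx]
    rw [modelAngle_eq hK, this, angleCos_sub hK hsy.ne' hsz.ne', Real.arccos_one]
  have n2 := upperAngle_nonneg hK ζ (reverseArc γ (dist O X))
  have n3 := upperAngle_nonneg hK (reverseArc η (dist O Y)) (reverseArc ζ (dist X Y))
  have e3 := modelAngle_le_pi hK (dist X Y) (dist O X) (dist O Y)
  by_contra hne
  have n1 := lt_of_le_of_ne (upperAngle_nonneg hK γ η) (Ne.symm hne)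
  have hlt : -1 < Real.cos (upperAngle K ζ (reverseArc γ (dist O X))) := by
    rw [← Real.cos_pi]
    exact Real.cos_lt_cos_of_nonneg_of_le_pi n2 le_rfl (by linarith)
  obtain ⟨c, hc1, hc2⟩ := exists_between hlt
  have hfv := first_variation hK hM.mul_dist_le_pi hζ hXY hc1.le hc2
  have hsmall : ∀ᶠ s : ℝ in 𝓝[>] 0, s < dist O X := nhdsWithin_le_nhds (eventually_lt_nhds hx)
  obtain ⟨s, ⟨h1, h2⟩, h3⟩ := ((hfv.and hsmall).and self_mem_nhdsWithin).exists
  replace h3 : 0 < s := h3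
  have h4 := dist_triangle O (γ (dist O X - s)) Y
  rw [hγ.dist_left ⟨by linarith, by linarith⟩] at h4
  rw [reverseArc] at h1
  nlinarith

end Hinge

section HingeComparison

variable {M : Type*} [MetricSpace M] {K : ℝ}

/-- One step of the descent: at a point `(x, y)` where the comparison angle at `O` is smaller than the
upper angle by `D` or more, the excess inequality makes one of the upper angles at `γ x` and `η y`
smaller than its counterpart in the `K`-plane by `D / 2` or more. -/
lemma exists_descent (hK : K ≠ 0) (hM : IsReDomain K M) {O X₀ Y₀ : M} {γ η : ℝ → M}
    (hγ : IsShortest γ O X₀) (hη : IsShortest η O Y₀) {x y : ℝ} (hx0 : 0 < x)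
    (hx : x ≤ dist O X₀) (hy0 : 0 < y) (hy : y ≤ dist O Y₀) {D κ : ℝ} (hD : 0 < D)
    (hω : modelAngle K x y (dist (γ x) (η y)) + D ≤ upperAngle K γ η)
    (hκx : κ * sn K x < (1 - Real.cos (D / 2)) / 2 * x)
    (hκy : κ * sn K y < (1 - Real.cos (D / 2)) / 2 * y) :
    (∀ᶠ h in 𝓝[>] 0,
      modelAngle K (x - h) y (dist (γ (x - h)) (η y)) - κ * Real.log (x - h) <
        modelAngle K x y (dist (γ x) (η y)) - κ * Real.log x) ∨
    (∀ᶠ h in 𝓝[>] 0,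
      modelAngle K x (y - h) (dist (γ x) (η (y - h))) - κ * Real.log (y - h) <
        modelAngle K x y (dist (γ x) (η y)) - κ * Real.log y) := by
  have hxd := hγ.dist_left ⟨hx0.le, hx⟩
  have hyd := hη.dist_left ⟨hy0.le, hy⟩
  have hOX : O ≠ γ x := dist_pos.1 (by rw [hxd]; exact hx0)
  have hOY : O ≠ η y := dist_pos.1 (by rw [hyd]; exact hy0)
  have hγx := hγ.initial ⟨hx0.le, hx⟩
  have hηy := hη.initial ⟨hy0.le, hy⟩
  have hωpos : 0 < upperAngle K γ η := by
    linarith [modelAngle_nonneg hK x y (dist (γ x) (η y))]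
  have hsx := hM.sn_dist_pos hK hOX
  have hsy := hM.sn_dist_pos hK hOY
  rw [hxd] at hsx
  rw [hyd] at hsy
  -- Points at equal distances from `O` do not coincide: else `γ (x / 2)` and `η y` would be two
  -- points as excluded by `upperAngle_eq_zero_of_dist_eq`.
  have hXY : γ x ≠ η y := by
    intro hXY
    have hxy : x = y := by rw [← hxd, ← hyd, hXY]
    have hm : x / 2 ∈ Icc 0 (dist O X₀) := ⟨by linarith, by linarith⟩
    have h1 := hγ.dist_left hm
    have h2 : dist (γ (x / 2)) (η y) = x / 2 := by
      rw [← hXY, hγ.isometry _ hm _ ⟨hx0.le, hx⟩, abs_sub_comm, abs_of_pos (by linarith)]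
      ring
    refine hωpos.ne' (upperAngle_eq_zero_of_dist_eq hK hM (hγ.initial hm) hηy
      (dist_pos.1 (by rw [h1]; positivity)) (dist_pos.1 (by rw [h2]; positivity)) ?_)
    rw [hyd, h1, h2, ← hxy]; ring
  have hmem := hM.angleCos_mem hK hOX hOY
  have hmemX := hM.angleCos_mem hK hOX.symm hXY
  have hmemY := hM.angleCos_mem hK hOY.symm hXY.symm
  rw [hxd, hyd] at hmem
  rw [dist_comm (γ x) O, hxd, hyd] at hmemX
  rw [dist_comm (η y) O, hyd, hxd, dist_comm (η y)] at hmemY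
  have h1 : -1 < angleCos K x y (dist (γ x) (η y)) := by
    refine lt_of_le_of_ne hmem.1 fun h => ?_
    rw [modelAngle_eq hK, ← h, Real.arccos_neg_one] at hω
    linarith [upperAngle_le_pi hK γ η]
  have h2 : angleCos K x y (dist (γ x) (η y)) < 1 := by
    refine lt_of_le_of_ne hmem.2 fun h => ?_
    have h3 := mul_angleCos hK hsx.ne' hsy.ne' (dist (γ x) (η y))
    rw [h] at h3
    have h4 : dist (γ x) (η y) = |x - y| := by
      have hle := abs_dist_sub_le (γ x) (η y) O
      rw [dist_comm _ O, hxd, dist_comm _ O, hyd] at hle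
      refine eq_of_cs_eq hK dist_nonneg (abs_nonneg _) (hM.mul_dist_le_pi _ _) (fun h => ?_) ?_
      · exact (mul_le_mul_of_nonneg_left hle (Real.sqrt_nonneg _)).trans (hM.mul_dist_le_pi _ _ h)
      · rw [cs_abs, cs_sub hK]; linarith
    have hne := dist_pos.2 hXY
    rcases le_total x y with hle | hle
    · refine hωpos.ne' (upperAngle_eq_zero_of_dist_eq hK hM hγx hηy hOX hXY ?_)
      rw [h4, hxd, hyd, abs_of_nonpos (by linarith)]; ring
    · refine hωpos.ne' ((upperAngle_comm hK _ _).trans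
        (upperAngle_eq_zero_of_dist_eq hK hM hηy hγx hOY hXY.symm ?_))
      rw [dist_comm (η y), h4, hxd, hyd, abs_of_nonneg (by linarith)]; ring
  obtain ⟨ζ, hζ⟩ := hM.geodesic (γ x) (η y)
  have hsum := hM.angle_sum_le hγx hηy hζ hOX hOY hXY
  rw [hxd, hyd] at hsum
  have hcos : Real.cos (D / 2) < 1 := by
    have hDpi : D ≤ Real.pi := by
      linarith [upperAngle_le_pi hK γ η, modelAngle_nonneg hK x y (dist (γ x) (η y))]
    rw [← Real.cos_zero]
    exact Real.cos_lt_cos_of_nonneg_of_le_pi le_rfl (by linarith) (by linarith)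
  have he : 0 < (1 - Real.cos (D / 2)) / 2 := by linarith
  by_cases hcase : upperAngle K ζ (reverseArc γ x) + D / 2 ≤
      modelAngle K (dist (γ x) (η y)) x y
  · left
    have h5 := cos_add_le_cos (upperAngle_nonneg hK _ _) (by linarith) hcase
      (modelAngle_le_pi hK _ _ _)
    rw [modelAngle_eq hK, angleCos_comm, Real.cos_arccos hmemX.1 hmemX.2] at h5
    have := eventually_modelAngle_sub_lt hK hM hγ hx0 hx hOY hXY hζ he hκx
      (by rwa [hyd]) (by rwa [hyd]) (by rw [hyd]; linarith)
    rwa [hyd] at this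
  · right
    have hcase' : upperAngle K (reverseArc ζ (dist (γ x) (η y))) (reverseArc η y) + D / 2 ≤
        modelAngle K y (dist (γ x) (η y)) x := by
      rw [upperAngle_comm hK]; linarith
    have h5 := cos_add_le_cos (upperAngle_nonneg hK _ _) (by linarith) hcase'
      (modelAngle_le_pi hK _ _ _)
    rw [modelAngle_eq hK, Real.cos_arccos hmemY.1 hmemY.2] at h5
    have := eventually_modelAngle_sub_lt hK hM hη hy0 hy hOX hXY.symm hζ.reverse he hκy
      (by rwa [hxd, angleCos_comm, dist_comm]) (by rwa [hxd, angleCos_comm, dist_comm])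
      (by rw [hxd, dist_comm (η y)]; linarith)
    rw [hxd] at this
    filter_upwards [this] with h hh
    rwa [modelAngle_comm hK, modelAngle_comm hK x y, dist_comm, dist_comm (γ x) (η y)]

/-- The comparison of angles in an `ℜ_K` domain: an upper angle is at most the corresponding angle of
a triangle of the `K`-plane with the same sides. -/
theorem upperAngle_le_modelAngle (hK : K ≠ 0) (hM : IsReDomain K M) {O X Y : M} {γ η : ℝ → M}
    (hγ : IsShortest γ O X) (hη : IsShortest η O Y) (hX : O ≠ X) (hY : O ≠ Y) :
    upperAngle K γ η ≤ modelAngle K (dist O X) (dist O Y) (dist X Y) := by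
  by_contra! hlt
  set x₀ := dist O X with hx₀
  set y₀ := dist O Y with hy₀
  have hx₀pos : 0 < x₀ := dist_pos.2 hX
  have hy₀pos : 0 < y₀ := dist_pos.2 hY
  set Γ₀ := modelAngle K x₀ y₀ (dist X Y) with hΓ₀
  set D := upperAngle K γ η - Γ₀ with hD
  have hDpos : 0 < D := by linarith
  have hΓ₀0 : 0 ≤ Γ₀ := modelAngle_nonneg hK _ _ _
  have hcos : Real.cos (D / 2) < 1 := by
    have hDpi : D ≤ Real.pi := by linarith [upperAngle_le_pi hK γ η]
    rw [← Real.cos_zero]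
    exact Real.cos_lt_cos_of_nonneg_of_le_pi le_rfl (by linarith) (by linarith)
  obtain ⟨C, hC, hsnC⟩ := exists_sn_le_mul hK (max x₀ y₀)
  set e := (1 - Real.cos (D / 2)) / 2 with he
  have hepos : 0 < e := by linarith
  set κ := e / (2 * C) with hκ
  have hκpos : 0 < κ := by positivity
  have hκC : κ * C = e / 2 := by rw [hκ]; field_simp
  have hκsn : ∀ x, 0 < x → x ≤ max x₀ y₀ → κ * sn K x < e * x := by
    intro x h1 h2
    have := mul_le_mul_of_nonneg_left (hsnC x ⟨h1.le, h2⟩) hκpos.le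
    nlinarith [mul_pos hepos h1]
  -- `δ` is so small that on the sides `x = δ`, `y = δ` of the rectangle below a minimum would be
  -- a negative angle.
  set r := Real.exp (-((Γ₀ + 1) / κ)) with hr
  have hr1 : r < 1 := by
    have := div_pos (by linarith : 0 < Γ₀ + 1) hκpos
    rw [hr, Real.exp_lt_one_iff]; linarith
  have hrpos : 0 < r := Real.exp_pos _
  set G : ℝ × ℝ → ℝ := fun p =>
    modelAngle K p.1 p.2 (dist (γ p.1) (η p.2)) - κ * (Real.log p.1 + Real.log p.2) with hG
  set S : Set (ℝ × ℝ) := Icc (r * x₀) x₀ ×ˢ Icc (r * y₀) y₀ with hS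
  have hrx : 0 < r * x₀ := by positivity
  have hry : 0 < r * y₀ := by positivity
  have hrx' : r * x₀ < x₀ := by nlinarith
  have hry' : r * y₀ < y₀ := by nlinarith
  have hpos : ∀ p ∈ S, 0 < p.1 ∧ 0 < p.2 := fun p hp =>
    ⟨hrx.trans_le hp.1.1, hry.trans_le hp.2.1⟩
  have hsn1 : ∀ p ∈ S, 0 < sn K p.1 ∧ 0 < sn K p.2 := by
    intro p hp
    refine ⟨sn_pos hK (hpos p hp).1 fun h => ?_, sn_pos hK (hpos p hp).2 fun h => ?_⟩
    · exact (mul_le_mul_of_nonneg_left hp.1.2 (Real.sqrt_nonneg _)).trans_lt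
        (hM.mul_dist_lt_pi _ _ h)
    · exact (mul_le_mul_of_nonneg_left hp.2.2 (Real.sqrt_nonneg _)).trans_lt
        (hM.mul_dist_lt_pi _ _ h)
  have hcont : ContinuousOn G S := by
    have c1 : ContinuousOn (fun p : ℝ × ℝ => γ p.1) S :=
      hγ.continuousOn.comp continuousOn_fst fun p hp => ⟨(hpos p hp).1.le, hp.1.2⟩
    have c2 : ContinuousOn (fun p : ℝ × ℝ => η p.2) S :=
      hη.continuousOn.comp continuousOn_snd fun p hp => ⟨(hpos p hp).2.le, hp.2.2⟩
    have c3 : ContinuousOn (fun p : ℝ × ℝ => dist (γ p.1) (η p.2)) S :=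
      continuous_dist.comp_continuousOn (ContinuousOn.prodMk c1 c2)
    have ccs := continuous_cs hK
    have csn := continuous_sn hK
    have c4 : ContinuousOn (fun p : ℝ × ℝ => angleCos K p.1 p.2 (dist (γ p.1) (η p.2))) S := by
      unfold angleCos
      refine ContinuousOn.div ?_ ?_ fun p hp => ?_
      · exact (ccs.comp_continuousOn c3).sub (by fun_prop)
      · fun_prop
      · have := hsn1 p hp
        exact mul_ne_zero (mul_ne_zero hK this.1.ne') this.2.ne'
    refine ContinuousOn.sub ?_ (continuousOn_const.mul (ContinuousOn.add ?_ ?_))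
    · simp only [modelAngle_eq hK]
      exact Real.continuous_arccos.comp_continuousOn c4
    · exact ContinuousOn.log continuousOn_fst fun p hp => (hpos p hp).1.ne'
    · exact ContinuousOn.log continuousOn_snd fun p hp => (hpos p hp).2.ne'
  have hne : (x₀, y₀) ∈ S := ⟨⟨hrx'.le, le_rfl⟩, ⟨hry'.le, le_rfl⟩⟩
  obtain ⟨⟨x, y⟩, hp, hmin⟩ := (isCompact_Icc.prod isCompact_Icc).exists_isMinOn ⟨_, hne⟩ hcont
  have hpp := hpos _ hp
  obtain ⟨⟨hx1, hx2⟩, hy1, hy2⟩ := hp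
  simp only at hpp hx1 hx2 hy1 hy2
  have hmin0 := hmin hne
  simp only [mem_ofPred_eq, hG] at hmin0
  rw [hγ.target, hη.target, ← hΓ₀] at hmin0
  have hlx := Real.log_le_log hpp.1 hx2
  have hly := Real.log_le_log hpp.2 hy2
  have hΓ0 := modelAngle_nonneg hK x y (dist (γ x) (η y))
  have hlogr : κ * Real.log r = -(Γ₀ + 1) := by rw [hr, Real.log_exp]; field_simp
  have hx3 : r * x₀ < x := by
    refine lt_of_le_of_ne hx1 fun h => ?_
    rw [← h] at hmin0 hΓ0
    rw [Real.log_mul hrpos.ne' hx₀pos.ne'] at hmin0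
    nlinarith
  have hy3 : r * y₀ < y := by
    refine lt_of_le_of_ne hy1 fun h => ?_
    rw [← h] at hmin0 hΓ0
    rw [Real.log_mul hrpos.ne' hy₀pos.ne'] at hmin0
    nlinarith
  have hΓ : modelAngle K x y (dist (γ x) (η y)) + D ≤ upperAngle K γ η := by
    have : modelAngle K x y (dist (γ x) (η y)) ≤ Γ₀ := by nlinarith
    linarith
  rcases exists_descent hK hM hγ hη hpp.1 hx2 hpp.2 hy2 hDpos hΓ
    (hκsn x hpp.1 (hx2.trans (le_max_left _ _))) (hκsn y hpp.2 (hy2.trans (le_max_right _ _)))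
    with h | h
  · have hs : ∀ᶠ t : ℝ in 𝓝[>] 0, t < x - r * x₀ :=
      nhdsWithin_le_nhds (eventually_lt_nhds (by linarith))
    obtain ⟨t, ⟨h1, h2⟩, h3⟩ := ((h.and hs).and self_mem_nhdsWithin).exists
    replace h3 : 0 < t := h3
    have hmem : (x - t, y) ∈ S := ⟨⟨by simp only; linarith, by simp only; linarith⟩, ⟨hy1, hy2⟩⟩
    have := hmin hmem
    simp only [mem_ofPred_eq, hG] at this
    linarith
  · have hs : ∀ᶠ t : ℝ in 𝓝[>] 0, t < y - r * y₀ :=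
      nhdsWithin_le_nhds (eventually_lt_nhds (by linarith))
    obtain ⟨t, ⟨h1, h2⟩, h3⟩ := ((h.and hs).and self_mem_nhdsWithin).exists
    replace h3 : 0 < t := h3
    have hmem : (x, y - t) ∈ S := ⟨⟨hx1, hx2⟩, ⟨by simp only; linarith, by simp only; linarith⟩⟩
    have := hmin hmem
    simp only [mem_ofPred_eq, hG] at this
    linarith

/-- The `ℜ_K` inequality for the distance from a point to a point of the opposite side: it is at
most the corresponding distance in the `K`-plane, which is given by Stewart's theorem. -/
theorem stewart_le (hK : K ≠ 0) (hM : IsReDomain K M) {P B : M} {γ : ℝ → M}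
    (hγ : IsShortest γ P B) (A : M) {t : ℝ} (ht : t ∈ Icc 0 (dist P B)) :
    0 ≤ K * (cs K (dist A (γ t)) * sn K (dist P B) -
      (sn K (dist P B - t) * cs K (dist A P) + sn K t * cs K (dist A B))) := by
  set d := dist P B with hd
  have hl := hγ.dist_left ht
  have hr := hγ.dist_right ht
  rw [← hd] at hr
  rcases ht.1.eq_or_lt with h0 | h0
  · rw [← h0, hγ.source, sub_zero, sn_zero]; apply le_of_eq; ring
  rcases ht.2.eq_or_lt with h1 | h1
  · rw [h1, hd, hγ.target, sub_self, sn_zero]; apply le_of_eq; ring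
  have hd' : sn K d = sn K (d - t) * cs K t + cs K (d - t) * sn K t := by
    rw [← sn_add, sub_add_cancel]
  by_cases hA : γ t = A
  · rw [← hA, dist_self, cs_zero, dist_comm _ P, hl, hr, hd']
    apply le_of_eq; ring
  obtain ⟨ζ, hζ⟩ := hM.geodesic (γ t) A
  have hRP : γ t ≠ P := dist_pos.1 (by rw [dist_comm, hl]; exact h0)
  have hRB : γ t ≠ B := dist_pos.1 (by rw [hr]; linarith)
  have hP := (hγ.initial ht).reverse
  rw [hl] at hP
  have hB := hγ.final ht
  have hopp : ∀ᶠ s in 𝓝[>] 0, dist (reverseArc γ t s) (γ (t + s)) = 2 * s := by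
    have e1 : ∀ᶠ s : ℝ in 𝓝[>] 0, s < t := nhdsWithin_le_nhds (eventually_lt_nhds h0)
    have e2 : ∀ᶠ s : ℝ in 𝓝[>] 0, s < d - t :=
      nhdsWithin_le_nhds (eventually_lt_nhds (by linarith))
    filter_upwards [e1, e2, self_mem_nhdsWithin] with s e1 e2 (hs : 0 < s)
    rw [reverseArc, hγ.isometry _ ⟨by linarith, by linarith⟩ _ ⟨by linarith, by linarith⟩,
      abs_of_neg (by linarith)]
    ring
  have hpi := pi_le_upperAngle_add hK hM.mul_dist_le_pi (ξ := ζ) hopp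
  have i1 := upperAngle_le_modelAngle hK hM hP hζ hRP hA
  have i2 := upperAngle_le_modelAngle hK hM hB hζ hRB hA
  rw [modelAngle_eq hK, dist_comm (γ t) P, hl, dist_comm P A] at i1
  rw [modelAngle_eq hK, hr, dist_comm B A] at i2
  have m1 := hM.angleCos_mem hK hRP hA
  have m2 := hM.angleCos_mem hK hRB hA
  rw [dist_comm (γ t) P, hl, dist_comm P A] at m1
  rw [hr, dist_comm B A] at m2
  have s1 := hM.sn_dist_pos hK hRP
  have s2 := hM.sn_dist_pos hK hRB
  have s3 := hM.sn_dist_pos hK hA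
  rw [dist_comm, hl] at s1
  rw [hr] at s2
  have hle : Real.arccos (-angleCos K (d - t) (dist (γ t) A) (dist A B)) ≤
      Real.arccos (angleCos K t (dist (γ t) A) (dist A P)) := by
    rw [Real.arccos_neg]; linarith
  have huv := (Real.strictAntiOn_arccos.le_iff_ge ⟨by linarith [m2.2], by linarith [m2.1]⟩ m1).1 hle
  have e1 := mul_angleCos hK s1.ne' s3.ne' (dist A P)
  have e2 := mul_angleCos hK s2.ne' s3.ne' (dist A B)
  rw [dist_comm A (γ t)]
  have : K * (cs K (dist (γ t) A) * sn K d -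
      (sn K (d - t) * cs K (dist A P) + sn K t * cs K (dist A B))) =
      K ^ 2 * sn K t * sn K (d - t) * sn K (dist (γ t) A) *
        (-angleCos K (d - t) (dist (γ t) A) (dist A B) -
          angleCos K t (dist (γ t) A) (dist A P)) := by
    rw [hd']
    linear_combination K * sn K (d - t) * e1 + K * sn K t * e2
  rw [this]
  have : 0 ≤ -angleCos K (d - t) (dist (γ t) A) (dist A B) -
          angleCos K t (dist (γ t) A) (dist A P) := by linarith
  positivity

end HingeComparison

/-! ### Four points -/

lemma sq_add_sq_cauchy {u v w z s t : ℝ} (hs : 0 ≤ s) (ht : 0 ≤ t) (h1 : u ^ 2 + w ^ 2 = s ^ 2)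
    (h2 : v ^ 2 + z ^ 2 = t ^ 2) : |-(u * v) + w * z| ≤ s * t := by
  apply abs_le_of_sq_le_sq _ (mul_nonneg hs ht)
  rw [mul_pow, ← h1, ← h2]
  nlinarith [sq_nonneg (u * z + w * v)]

/-- A broken line with the legs `ρ₁`, `ρ₂` is no shorter than the segment `f` between its ends; if
`cᵢ`, `nᵢ` are the cosine and the sine of an arc no shorter than `ρᵢ`, it follows that `f` is at most
the sum of the two arcs. -/
lemma mul_cs_sub_nonneg_of_le_add {K f ρ₁ ρ₂ c₁ c₂ n₁ n₂ : ℝ} (hK : K ≠ 0) (hf : 0 ≤ f)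
    (hfρ : f ≤ ρ₁ + ρ₂) (h₁ : 0 ≤ ρ₁) (h₂ : 0 ≤ ρ₂) (hc₁ : 0 ≤ c₁) (hc₂ : 0 ≤ c₂) (hn₁ : 0 ≤ n₁)
    (hn₂ : 0 ≤ n₂) (e₁ : c₁ ^ 2 + K * n₁ ^ 2 = 1) (e₂ : c₂ ^ 2 + K * n₂ ^ 2 = 1)
    (hρ₁ : 0 ≤ K * (cs K ρ₁ - c₁)) (hρ₂ : 0 ≤ K * (cs K ρ₂ - c₂))
    (hr₁ : 0 < K → √K * ρ₁ ≤ Real.pi) (hr₂ : 0 < K → √K * ρ₂ ≤ Real.pi) :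
    0 ≤ K * (cs K f - (c₁ * c₂ - K * n₁ * n₂)) := by
  have i₁ := cs_sq hK ρ₁
  have i₂ := cs_sq hK ρ₂
  have j₁ := sn_nonneg hK h₁ hr₁
  have j₂ := sn_nonneg hK h₂ hr₂
  by_cases h : 0 < K
  · have k₁ : c₁ ≤ cs K ρ₁ := by nlinarith
    have k₂ : c₂ ≤ cs K ρ₂ := by nlinarith
    have hhalf : ∀ ρ, 0 ≤ cs K ρ → √K * ρ ≤ Real.pi → √K * ρ ≤ Real.pi / 2 := by
      intro ρ h1 h2
      by_contra! h3
      have := Real.cos_neg_of_pi_div_two_lt_of_lt h3 (by linarith [Real.pi_pos])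
      simp only [cs, h, if_true] at h1
      linarith
    have l₁ := hhalf ρ₁ (hc₁.trans k₁) (hr₁ h)
    have l₂ := hhalf ρ₂ (hc₂.trans k₂) (hr₂ h)
    have hadd := mul_cs_sub_cs_nonneg hK hf hfρ (fun _ => by rw [mul_add]; linarith)
    rw [cs_add hK] at hadd
    have m₁ : sn K ρ₁ ≤ n₁ := by
      rw [← sq_le_sq₀ j₁ hn₁]
      nlinarith
    have m₂ : sn K ρ₂ ≤ n₂ := by
      rw [← sq_le_sq₀ j₂ hn₂]
      nlinarith
    have a1 := mul_le_mul k₁ k₂ hc₂ (hc₁.trans k₁)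
    have a2 := mul_le_mul m₁ m₂ j₂ hn₁
    have a3 := mul_le_mul_of_nonneg_left a2 h.le
    have : 0 ≤ cs K f - (cs K ρ₁ * cs K ρ₂ - K * sn K ρ₁ * sn K ρ₂) :=
      (mul_nonneg_iff_of_pos_left h).1 hadd
    apply mul_nonneg h.le
    nlinarith
  · have hn := neg_of_not_pos hK h
    have k₁ : cs K ρ₁ ≤ c₁ := by nlinarith
    have k₂ : cs K ρ₂ ≤ c₂ := by nlinarith
    have hadd := mul_cs_sub_cs_nonneg hK hf hfρ (fun h' => absurd h' h)
    rw [cs_add hK] at hadd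
    have o₁ := one_le_cs h ρ₁
    have o₂ := one_le_cs h ρ₂
    have m₁ : sn K ρ₁ ≤ n₁ := by
      rw [← sq_le_sq₀ j₁ hn₁]
      nlinarith
    have m₂ : sn K ρ₂ ≤ n₂ := by
      rw [← sq_le_sq₀ j₂ hn₂]
      nlinarith
    have a1 := mul_le_mul k₁ k₂ (by linarith) hc₁
    have a2 := mul_le_mul m₁ m₂ j₂ hn₁
    have a3 := mul_le_mul_of_nonpos_left a2 hn.le
    have : cs K f - (cs K ρ₁ * cs K ρ₂ - K * sn K ρ₁ * sn K ρ₂) ≤ 0 := by nlinarith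
    apply mul_nonneg_of_nonpos_of_nonpos hn.le
    nlinarith

lemma cs_sq_rotate {K p h c s ct st : ℝ} (h1 : p ^ 2 + h ^ 2 = s ^ 2) (h2 : c ^ 2 + K * s ^ 2 = 1)
    (h3 : ct ^ 2 + K * st ^ 2 = 1) :
    (c * ct + K * p * st) ^ 2 + K * ((p * ct - c * st) ^ 2 + h ^ 2) = 1 := by
  linear_combination (c ^ 2 + K * p ^ 2) * h3 + K * h1 + h2

/-- Plane vectors `(e₁, h)` and `(e₂, -k)` on the two sides of an axis, with the lengths `n₁`, `n₂`,
are opposite if their first coordinates are in the proportion `-n₁ : n₂`. -/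
lemma mul_eq_of_opposite {e₁ e₂ h k n₁ n₂ : ℝ} (hh : 0 ≤ h) (hk : 0 ≤ k) (hn₁ : 0 ≤ n₁)
    (hn₂ : 0 ≤ n₂) (m₁ : n₁ ^ 2 = e₁ ^ 2 + h ^ 2) (m₂ : n₂ ^ 2 = e₂ ^ 2 + k ^ 2)
    (hroot : n₂ * e₁ = -(n₁ * e₂)) : n₁ * n₂ = h * k - e₁ * e₂ := by
  have hopp : e₁ * e₂ ≤ 0 := by
    rcases hn₁.eq_or_lt with h0 | h0
    · have : e₁ = 0 := by
        rw [← h0] at m₁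
        nlinarith [sq_nonneg e₁, sq_nonneg h]
      rw [this]; simp
    · have : n₁ * (e₁ * e₂) = -(n₂ * e₁ ^ 2) := by linear_combination e₁ * hroot
      have h2 : 0 ≤ n₂ * e₁ ^ 2 := by positivity
      by_contra! hc
      linarith [mul_pos h0 hc]
  have hhk := mul_nonneg hh hk
  have u1 : (e₁ * k) ^ 2 = (e₂ * h) ^ 2 := by
    have : (n₂ * e₁) ^ 2 = (n₁ * e₂) ^ 2 := by rw [hroot]; ring
    rw [mul_pow, mul_pow, m₁, m₂] at this
    linarith
  have u2 : e₁ * k + e₂ * h = 0 := by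
    rcases sq_eq_sq_iff_eq_or_eq_neg.1 u1 with u | u
    · have h3 : (e₁ * k) * (e₂ * h) ≤ 0 := by
        have : (e₁ * k) * (e₂ * h) = (e₁ * e₂) * (h * k) := by ring
        rw [this]; exact mul_nonpos_of_nonpos_of_nonneg hopp hhk
      rw [← u] at h3 ⊢
      have : e₁ * k = 0 := by
        have := mul_self_nonneg (e₁ * k)
        exact mul_self_eq_zero.1 (by linarith)
      linarith
    · linarith
  have : (n₁ * n₂) ^ 2 = (h * k - e₁ * e₂) ^ 2 := by
    rw [mul_pow, m₁, m₂]
    linear_combination (e₁ * k + e₂ * h) * u2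
  exact (sq_eq_sq₀ (mul_nonneg hn₁ hn₂) (by linarith)).1 this

section FourPoints

variable {M : Type*} [MetricSpace M] {K : ℝ}

/-- Place `B` and `P` in the `K`-plane. Then there is a place for `A`, with the coordinates `p` along
`BP` and `h` across it. -/
lemma exists_coordinates (hK : K ≠ 0) (hM : IsReDomain K M) {B P : M} (hBP : B ≠ P) (A : M) :
    ∃ p h, 0 ≤ h ∧ p ^ 2 + h ^ 2 = sn K (dist B A) ^ 2 ∧
      cs K (dist P A) = cs K (dist B A) * cs K (dist B P) + K * p * sn K (dist B P) := by
  by_cases hA : B = A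
  · subst hA
    exact ⟨0, 0, le_rfl, by simp [sn_zero], by simp [cs_zero, dist_comm]⟩
  have sA := hM.sn_dist_pos hK hA
  have sP := hM.sn_dist_pos hK hBP
  have hc := hM.angleCos_mem hK hA hBP
  set c := angleCos K (dist B A) (dist B P) (dist A P) with hcdef
  have e := mul_angleCos hK sA.ne' sP.ne' (dist A P)
  refine ⟨sn K (dist B A) * c, sn K (dist B A) * √(1 - c ^ 2), by positivity, ?_, ?_⟩
  · rw [mul_pow, mul_pow, Real.sq_sqrt (by nlinarith [hc.1, hc.2])]; ring
  · rw [dist_comm P A, hcdef]; linarith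

/-- Four points of an `ℜ_K` domain. The triangles `ABP` and `QBP` have copies in the `K`-plane, on
the two sides of a common side `BP`. Either the angles of these copies at `B`, or those at `P`, add up
to at least `π` (the first two cases, in the form of Stewart's theorem), or the distance `AQ` is at
most the distance between the copies of `A` and `Q`. -/
theorem four_points (hK : K ≠ 0) (hM : IsReDomain K M) {B P : M} (hBP : B ≠ P) (A Q : M)
    (hBA : 0 ≤ cs K (dist B A)) (hPA : 0 ≤ cs K (dist P A)) (hBQ : 0 ≤ cs K (dist B Q))
    (hPQ : 0 ≤ cs K (dist P Q)) :
    K * (sn K (dist B Q) * cs K (dist P A) + sn K (dist B A) * cs K (dist P Q) -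
        sn K (dist B A + dist B Q) * cs K (dist B P)) ≤ 0 ∨
    K * (sn K (dist P Q) * cs K (dist B A) + sn K (dist P A) * cs K (dist B Q) -
        sn K (dist P A + dist P Q) * cs K (dist B P)) ≤ 0 ∨
    ∃ p h q k : ℝ, p ^ 2 + h ^ 2 = sn K (dist B A) ^ 2 ∧ q ^ 2 + k ^ 2 = sn K (dist B Q) ^ 2 ∧
      cs K (dist P A) = cs K (dist B A) * cs K (dist B P) + K * p * sn K (dist B P) ∧
      cs K (dist P Q) = cs K (dist B Q) * cs K (dist B P) + K * q * sn K (dist B P) ∧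
      0 ≤ K * (cs K (dist A Q) -
        (cs K (dist B A) * cs K (dist B Q) + K * (p * q - h * k))) := by
  obtain ⟨p, h, hh, h1, h2⟩ := exists_coordinates hK hM hBP A
  obtain ⟨q, k, hk, h3, h4⟩ := exists_coordinates hK hM hBP Q
  obtain ⟨γ, hγ⟩ := hM.geodesic B P
  have st : ∀ A : M, ∀ t ∈ Icc 0 (dist B P), _ := fun A t ht => stewart_le hK hM hγ A ht
  have sd := hM.sn_dist_pos hK hBP
  have rangeA := hM.mul_dist_le_pi
  have nsn : ∀ X Y : M, 0 ≤ sn K (dist X Y) := fun X Y => sn_nonneg hK dist_nonneg (rangeA X Y)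
  have ea := cs_sq hK (dist B A)
  have ey := cs_sq hK (dist B Q)
  have ed := cs_sq hK (dist B P)
  have ex := cs_sq hK (dist P A)
  have eb := cs_sq hK (dist P Q)
  have na := nsn B A
  have ny := nsn B Q
  have nx := nsn P A
  have nb := nsn P Q
  have hdiv : ∀ t, sn K (dist B P - t) =
      sn K (dist B P) * cs K t - cs K (dist B P) * sn K t := sn_sub K _
  have hsnd : ∀ t ∈ Icc 0 (dist B P), 0 ≤ sn K t ∧ 0 ≤ sn K (dist B P - t) := by
    intro t ht
    have hle : ∀ s, s ≤ dist B P → 0 < K → √K * s ≤ Real.pi := fun s hs h =>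
      (mul_le_mul_of_nonneg_left hs (Real.sqrt_nonneg _)).trans (rangeA B P h)
    exact ⟨sn_nonneg hK ht.1 (hle _ ht.2),
      sn_nonneg hK (by linarith [ht.2]) (hle _ (by linarith [ht.1]))⟩
  rw [sn_add, sn_add]
  set a := dist B A
  set x := dist P A
  set y := dist B Q
  set b := dist P Q
  set d := dist B P with hd
  -- `e₁`, `e₂` are, up to a factor, the cosines of the angles that the segments from the copies of `A`
  -- and `Q` to the point at distance `t` from `B` form with `BP`. `g` vanishes when these segments
  -- have opposite directions.
  set e₁ : ℝ → ℝ := fun t => p * cs K t - cs K a * sn K t with he₁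
  set e₂ : ℝ → ℝ := fun t => q * cs K t - cs K y * sn K t with he₂
  set n₁ : ℝ → ℝ := fun t => √(e₁ t ^ 2 + h ^ 2) with hn₁
  set n₂ : ℝ → ℝ := fun t => √(e₂ t ^ 2 + k ^ 2) with hn₂
  set g : ℝ → ℝ := fun t => n₂ t * e₁ t + n₁ t * e₂ t with hg
  have hK2 : 0 < K ^ 2 := by positivity
  by_cases hg0 : g 0 ≤ 0
  · left
    have z1 : n₁ 0 = sn K a := by
      simp only [hn₁, he₁, cs_zero, sn_zero, mul_one, mul_zero, sub_zero]
      rw [h1, Real.sqrt_sq na]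
    have z2 : n₂ 0 = sn K y := by
      simp only [hn₂, he₂, cs_zero, sn_zero, mul_one, mul_zero, sub_zero]
      rw [h3, Real.sqrt_sq ny]
    simp only [hg, z1, z2, he₁, he₂, cs_zero, sn_zero, mul_one, mul_zero, sub_zero] at hg0
    rw [h2, h4]
    have : K * (sn K y * (cs K a * cs K d + K * p * sn K d) +
        sn K a * (cs K y * cs K d + K * q * sn K d) -
        (sn K a * cs K y + cs K a * sn K y) * cs K d) =
      (K ^ 2 * sn K d) * (sn K y * p + sn K a * q) := by ring
    rw [this]
    exact mul_nonpos_of_nonneg_of_nonpos (by positivity) hg0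
  by_cases hgd : 0 ≤ g d
  · right; left
    have w1 : K * e₁ d * sn K d = cs K x * cs K d - cs K a := by
      simp only [he₁]; rw [h2]; linear_combination (-cs K a) * ed
    have w2 : K * e₂ d * sn K d = cs K b * cs K d - cs K y := by
      simp only [he₂]; rw [h4]; linear_combination (-cs K y) * ed
    have z1 : n₁ d = sn K x := by
      rw [hn₁, ← Real.sqrt_sq nx]
      refine congrArg Real.sqrt ?_
      apply mul_left_cancel₀ hK
      have := cs_sq_rotate h1 ea ed
      rw [← h2] at this
      simp only [he₁]; linarith
    have z2 : n₂ d = sn K b := by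
      rw [hn₂, ← Real.sqrt_sq nb]
      refine congrArg Real.sqrt ?_
      apply mul_left_cancel₀ hK
      have := cs_sq_rotate h3 ey ed
      rw [← h4] at this
      simp only [he₂]; linarith
    simp only [hg, z1, z2] at hgd
    have : K * (sn K b * cs K a + sn K x * cs K y -
        (sn K x * cs K b + cs K x * sn K b) * cs K d) =
      -((K ^ 2 * sn K d) * (sn K b * e₁ d + sn K x * e₂ d)) := by
      linear_combination K * sn K b * w1 + K * sn K x * w2
    rw [this, neg_nonpos]
    positivity
  right; right
  push Not at hg0 hgd
  refine ⟨p, h, q, k, h1, h3, h2, h4, ?_⟩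
  have hcont : ContinuousOn g (Icc 0 d) := by
    have := continuous_cs hK
    have := continuous_sn hK
    apply Continuous.continuousOn
    simp only [hg, hn₁, hn₂, he₁, he₂]
    fun_prop
  obtain ⟨t, ht, hgt⟩ := intermediate_value_Icc' dist_nonneg hcont ⟨hgd.le, hg0.le⟩
  obtain ⟨s1, s2⟩ := hsnd t ht
  have et := cs_sq hK t
  -- `c₁`, `c₂` are the cosines of the lengths of these segments, `n₁ t`, `n₂ t` their sines.
  set c₁ := cs K a * cs K t + K * p * sn K t with hc₁
  set c₂ := cs K y * cs K t + K * q * sn K t with hc₂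
  have t1 : sn K d * c₁ = sn K (d - t) * cs K a + sn K t * cs K x := by
    rw [hdiv, h2, hc₁]; ring
  have t2 : sn K d * c₂ = sn K (d - t) * cs K y + sn K t * cs K b := by
    rw [hdiv, h4, hc₂]; ring
  have p1 : 0 ≤ c₁ := (mul_nonneg_iff_of_pos_left sd).1 (by rw [t1]; positivity)
  have p2 : 0 ≤ c₂ := (mul_nonneg_iff_of_pos_left sd).1 (by rw [t2]; positivity)
  have q1 : 0 ≤ K * (cs K (dist A (γ t)) - c₁) := by
    have := st A t ht
    rw [dist_comm A B, dist_comm A P, ← t1] at this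
    exact (mul_nonneg_iff_of_pos_left sd).1 (by linarith)
  have q2 : 0 ≤ K * (cs K (dist Q (γ t)) - c₂) := by
    have := st Q t ht
    rw [dist_comm Q B, dist_comm Q P, ← t2] at this
    exact (mul_nonneg_iff_of_pos_left sd).1 (by linarith)
  have m1 : n₁ t ^ 2 = e₁ t ^ 2 + h ^ 2 := Real.sq_sqrt (by positivity)
  have m2 : n₂ t ^ 2 = e₂ t ^ 2 + k ^ 2 := Real.sq_sqrt (by positivity)
  have n1 : 0 ≤ n₁ t := Real.sqrt_nonneg _
  have n2 : 0 ≤ n₂ t := Real.sqrt_nonneg _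
  have r1 : c₁ ^ 2 + K * n₁ t ^ 2 = 1 := by
    rw [m1]; exact cs_sq_rotate h1 ea et
  have r2 : c₂ ^ 2 + K * n₂ t ^ 2 = 1 := by
    rw [m2]; exact cs_sq_rotate h3 ey et
  have hF : cs K a * cs K y + K * (p * q - h * k) = c₁ * c₂ + K * (e₁ t * e₂ t - h * k) := by
    simp only [he₁, he₂, hc₁, hc₂]
    linear_combination (-(cs K a * cs K y) - K * p * q) * et
  have hroot : n₂ t * e₁ t = -(n₁ t * e₂ t) := by
    have : n₂ t * e₁ t + n₁ t * e₂ t = 0 := hgt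
    linarith
  have hprod := mul_eq_of_opposite hh hk n1 n2 m1 m2 hroot
  have := mul_cs_sub_nonneg_of_le_add hK dist_nonneg (dist_triangle A (γ t) Q) dist_nonneg
    dist_nonneg p1 p2 n1 n2 r1 r2 q1 (by rwa [dist_comm]) (rangeA _ _) (rangeA _ _)
  rw [hF]
  have e : c₁ * c₂ - K * n₁ t * n₂ t = c₁ * c₂ + K * (e₁ t * e₂ t - h * k) := by
    linear_combination (-K) * hprod
  rwa [e] at this

end FourPoints

/-! ### The quadrilateral cosine -/

section Algebra

variable {K ca sa cx sx cy sy cb sb cd sd cf sf : ℝ}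

/-- The upper bound, if the copies of the triangles `ABP`, `QBP` make an angle of at least `π` at
`B`. -/
lemma upper_of_straight_left (hsa : 0 < sa) (hsy : 0 ≤ sy) (hca : 0 ≤ 1 + ca)
    (hxd : 0 ≤ cx + cd) (ea : ca ^ 2 + K * sa ^ 2 = 1)
    (hS : K * (sy * cx + sa * cb - (sa * cy + ca * sy) * cd) ≤ 0)
    (hf : 0 ≤ K * (cf - (ca * cy - K * sa * sy)))
    (hd : 0 ≤ K * (ca * cx + K * sa * sx - cd)) :
    K * ((cb + cx * cy - K * sx * sy) * (1 + ca) - (cx + cd) * (cy + cf)) ≤ 0 := by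
  have key : sa * (K * ((cb + cx * cy - K * sx * sy) * (1 + ca) - (cx + cd) * (cy + cf))) =
      (1 + ca) * (K * (sy * cx + sa * cb - (sa * cy + ca * sy) * cd)) -
      sa * (cx + cd) * (K * (cf - (ca * cy - K * sa * sy))) -
      sy * (1 + ca) * (K * (ca * cx + K * sa * sx - cd)) := by grind
  refine nonpos_of_mul_nonpos_right (a := sa) ?_ hsa
  rw [key]
  have h1 := mul_nonpos_of_nonneg_of_nonpos hca hS
  have h2 := mul_nonneg (mul_nonneg hsa.le hxd) hf
  have h3 := mul_nonneg (mul_nonneg hsy hca) hd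
  linarith

/-- The upper bound, if the copies of the triangles `ABP`, `QBP` make an angle of at least `π` at
`P`. -/
lemma upper_of_straight_right (hsb : 0 < sb) (hsx : 0 ≤ sx)
    (hxd : 0 ≤ cx + cd) (ex : cx ^ 2 + K * sx ^ 2 = 1) (ey : cy ^ 2 + K * sy ^ 2 = 1)
    (eb : cb ^ 2 + K * sb ^ 2 = 1)
    (hE : 0 ≤ cb + cx * cy - K * sx * sy)
    (hxby : 0 ≤ 1 + ((cx * cb - K * sx * sb) * cy - K * (sx * cb + cx * sb) * sy))
    (hS : K * (sb * ca + sx * cy - (sx * cb + cx * sb) * cd) ≤ 0)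
    (hf : 0 ≤ K * (cf - (cx * cb - K * sx * sb)))
    (hd : 0 ≤ K * (cb * cy + K * sb * sy - cd)) :
    K * ((cb + cx * cy - K * sx * sy) * (1 + ca) - (cx + cd) * (cy + cf)) ≤ 0 := by
  have key : sb * (K * ((cb + cx * cy - K * sx * sy) * (1 + ca) - (cx + cd) * (cy + cf))) =
      (cb + cx * cy - K * sx * sy) * (K * (sb * ca + sx * cy - (sx * cb + cx * sb) * cd)) -
      sb * (cx + cd) * (K * (cf - (cx * cb - K * sx * sb))) -
      sx * (1 + ((cx * cb - K * sx * sb) * cy - K * (sx * cb + cx * sb) * sy)) *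
        (K * (cb * cy + K * sb * sy - cd)) := by grind
  refine nonpos_of_mul_nonpos_right (a := sb) ?_ hsb
  rw [key]
  have h1 := mul_nonpos_of_nonneg_of_nonpos hE hS
  have h2 := mul_nonneg (mul_nonneg hsb.le hxd) hf
  have h3 := mul_nonneg (mul_nonneg hsx hxby) hd
  linarith

/-- The lower bound, if the copies of the triangles `ABP`, `ABQ` make an angle of at least `π` at
`A`. -/
lemma lower_of_straight (hsf : 0 < sf) (hsx : 0 ≤ sx) (hca : 0 ≤ 1 + ca) (hyf : 0 ≤ cy + cf)
    (ey : cy ^ 2 + K * sy ^ 2 = 1) (ef : cf ^ 2 + K * sf ^ 2 = 1)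
    (hfy : 0 ≤ 1 + (cf * cy - K * sf * sy))
    (hS : K * (sf * cd + sx * cy - (sx * cf + cx * sf) * ca) ≤ 0)
    (hb : 0 ≤ K * (cb - (cx * cf - K * sx * sf)))
    (ha : 0 ≤ K * (cf * cy + K * sf * sy - ca)) :
    0 ≤ K * ((cb + cx * cy + K * sx * sy) * (1 + ca) - (cx + cd) * (cy + cf)) := by
  have key : sf * (K * ((cb + cx * cy + K * sx * sy) * (1 + ca) - (cx + cd) * (cy + cf))) =
      sf * (1 + ca) * (K * (cb - (cx * cf - K * sx * sf))) -
      (cy + cf) * (K * (sf * cd + sx * cy - (sx * cf + cx * sf) * ca)) +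
      sx * (1 + (cf * cy - K * sf * sy)) * (K * (cf * cy + K * sf * sy - ca)) := by grind
  refine nonneg_of_mul_nonneg_right (a := sf) ?_ hsf
  rw [key]
  have h1 := mul_nonpos_of_nonneg_of_nonpos hyf hS
  have h2 := mul_nonneg (mul_nonneg hsf.le hca) hb
  have h3 := mul_nonneg (mul_nonneg hsx hfy) ha
  linarith

/-- The identities behind `upper_of_convex`: the inner product as a sum of products of coordinates
along and across `AB`, and the lengths of the two vectors. -/
lemma upper_identities {p h q k F : ℝ} (ea : ca ^ 2 + K * sa ^ 2 = 1)
    (ed : cd ^ 2 + K * sd ^ 2 = 1) (ex : cx ^ 2 + K * sx ^ 2 = 1)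
    (h1 : p ^ 2 + h ^ 2 = sa ^ 2) (h2 : q ^ 2 + k ^ 2 = sy ^ 2) (hx : cx = ca * cd + K * p * sd)
    (hb : cb = cy * cd + K * q * sd) (hF : F = ca * cy + K * (p * q - h * k)) :
    (1 - ca) * ((cb + cx * cy) * (1 + ca) - (cx + cd) * (cy + F)) =
      -((cd - cx * ca) * (F - cy * ca)) + (K * h * sd) * (K * (p * k + h * q)) ∧
    (cd - cx * ca) ^ 2 + (K * h * sd) ^ 2 = K ^ 2 * sx ^ 2 * sa ^ 2 ∧
    (F - cy * ca) ^ 2 + (K * (p * k + h * q)) ^ 2 = K ^ 2 * sy ^ 2 * sa ^ 2 := by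
  refine ⟨?_, ?_, ?_⟩ <;> grind

/-- The identities behind `lower_of_convex`. -/
lemma lower_identities {p h q k F : ℝ} (ea : ca ^ 2 + K * sa ^ 2 = 1)
    (ex : cx ^ 2 + K * sx ^ 2 = 1) (ed : cd ^ 2 + K * sd ^ 2 = 1)
    (h1 : p ^ 2 + h ^ 2 = sd ^ 2) (h2 : q ^ 2 + k ^ 2 = sy ^ 2) (hx : cx = cd * ca + K * p * sa)
    (hf : cf = cy * ca + K * q * sa) (hF : F = cd * cy + K * (p * q - h * k)) :
    (1 - ca) * ((F + cx * cy) * (1 + ca) - (cx + cd) * (cy + cf)) =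
      -((cd - cx * ca) * (cf - cy * ca)) + (K * sa * h) * (-(K * sa * k)) ∧
    (cd - cx * ca) ^ 2 + (K * sa * h) ^ 2 = K ^ 2 * sx ^ 2 * sa ^ 2 ∧
    (cf - cy * ca) ^ 2 + (-(K * sa * k)) ^ 2 = K ^ 2 * sy ^ 2 * sa ^ 2 := by
  refine ⟨by clear h1 h2 ex ed; grind, ?_, ?_⟩
  · have h3 := cs_sq_rotate h1 ed ea
    rw [← hx] at h3
    have h4 : cd - cx * ca = -(K * sa * (p * ca - cd * sa)) := by
      rw [hx]; linear_combination (-cd) * ea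
    rw [h4]
    linear_combination K * sa ^ 2 * (h3 - ex)
  · have h4 : cf - cy * ca = K * q * sa := by rw [hf]; ring
    rw [h4]
    linear_combination K ^ 2 * sa ^ 2 * h2

/-- The upper bound, if the copies of the triangles `ABP`, `QBP` form a convex quadrilateral with the
diagonal `BP`. In coordinates with the pole `B`, `cosq` is bounded by the inner product of two unit
vectors, of which one is parallel transported along the copy of `AB`. -/
lemma upper_of_convex {p h q k : ℝ} (hsa : 0 < sa) (hsx : 0 ≤ sx) (hsy : 0 ≤ sy) (hK : K ≠ 0)
    (hca : 0 < 1 + ca) (hxd : 0 ≤ cx + cd) (ea : ca ^ 2 + K * sa ^ 2 = 1)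
    (ed : cd ^ 2 + K * sd ^ 2 = 1) (ex : cx ^ 2 + K * sx ^ 2 = 1)
    (h1 : p ^ 2 + h ^ 2 = sa ^ 2) (h2 : q ^ 2 + k ^ 2 = sy ^ 2) (hx : cx = ca * cd + K * p * sd)
    (hb : cb = cy * cd + K * q * sd) (hf : 0 ≤ K * (cf - (ca * cy + K * (p * q - h * k)))) :
    K * ((cb + cx * cy - K * sx * sy) * (1 + ca) - (cx + cd) * (cy + cf)) ≤ 0 := by
  obtain ⟨F, hF⟩ : ∃ F, F = ca * cy + K * (p * q - h * k) := ⟨_, rfl⟩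
  rw [← hF] at hf
  obtain ⟨e3, e1, e2⟩ := upper_identities ea ed ex h1 h2 hx hb hF
  have hab : ∀ s : ℝ, K ^ 2 * s ^ 2 * sa ^ 2 = (|K| * s * sa) ^ 2 := fun s => by
    rw [mul_pow, mul_pow, sq_abs]
  rw [hab] at e1 e2
  have hcs := le_of_abs_le (sq_add_sq_cauchy (by positivity) (by positivity) e1 e2)
  have e4 : |K| * sx * sa * (|K| * sy * sa) = K * sx * sy * ((1 - ca) * (1 + ca)) := by
    have : |K| * sx * sa * (|K| * sy * sa) = |K| ^ 2 * sa ^ 2 * sx * sy := by ring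
    rw [this, sq_abs]; linear_combination K * sx * sy * ea
  rw [e4, ← e3] at hcs
  have hpos : 0 < K * (1 - ca) := by
    have : K * (1 - ca) * (1 + ca) = K ^ 2 * sa ^ 2 := by linear_combination (-K) * ea
    have h3 : 0 < K ^ 2 * sa ^ 2 := by positivity
    rw [← this] at h3
    exact (pos_iff_pos_of_mul_pos h3).2 hca
  have hG : K * ((cb + cx * cy - K * sx * sy) * (1 + ca) - (cx + cd) * (cy + F)) ≤ 0 := by
    refine nonpos_of_mul_nonpos_right (a := K * (1 - ca)) ?_ hpos
    have : K * (1 - ca) * (K * ((cb + cx * cy - K * sx * sy) * (1 + ca) - (cx + cd) * (cy + F))) =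
      K ^ 2 * ((1 - ca) * ((cb + cx * cy) * (1 + ca) - (cx + cd) * (cy + F)) -
        K * sx * sy * ((1 - ca) * (1 + ca))) := by ring
    rw [this]
    exact mul_nonpos_of_nonneg_of_nonpos (sq_nonneg K) (by linarith)
  have := mul_nonneg hxd hf
  linarith

/-- The lower bound, if the copies of the triangles `ABP`, `ABQ` form a convex quadrilateral with the
diagonal `AB`. -/
lemma lower_of_convex {p h q k : ℝ} (hsa : 0 < sa) (hsx : 0 ≤ sx) (hsy : 0 ≤ sy) (hK : K ≠ 0)
    (hca : 0 < 1 + ca) (ea : ca ^ 2 + K * sa ^ 2 = 1) (ex : cx ^ 2 + K * sx ^ 2 = 1)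
    (ed : cd ^ 2 + K * sd ^ 2 = 1)
    (h1 : p ^ 2 + h ^ 2 = sd ^ 2) (h2 : q ^ 2 + k ^ 2 = sy ^ 2) (hx : cx = cd * ca + K * p * sa)
    (hf : cf = cy * ca + K * q * sa) (hb : 0 ≤ K * (cb - (cd * cy + K * (p * q - h * k)))) :
    0 ≤ K * ((cb + cx * cy + K * sx * sy) * (1 + ca) - (cx + cd) * (cy + cf)) := by
  obtain ⟨F, hF⟩ : ∃ F, F = cd * cy + K * (p * q - h * k) := ⟨_, rfl⟩
  rw [← hF] at hb
  obtain ⟨e3, e1, e2⟩ := lower_identities ea ex ed h1 h2 hx hf hF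
  have hab : ∀ s : ℝ, K ^ 2 * s ^ 2 * sa ^ 2 = (|K| * s * sa) ^ 2 := fun s => by
    rw [mul_pow, mul_pow, sq_abs]
  rw [hab] at e1 e2
  have hcs := neg_le_of_abs_le (sq_add_sq_cauchy (by positivity) (by positivity) e1 e2)
  have e4 : |K| * sx * sa * (|K| * sy * sa) = K * sx * sy * ((1 - ca) * (1 + ca)) := by
    have : |K| * sx * sa * (|K| * sy * sa) = |K| ^ 2 * sa ^ 2 * sx * sy := by ring
    rw [this, sq_abs]; linear_combination K * sx * sy * ea
  rw [e4, ← e3] at hcs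
  have hpos : 0 < K * (1 - ca) := by
    have : K * (1 - ca) * (1 + ca) = K ^ 2 * sa ^ 2 := by linear_combination (-K) * ea
    have h3 : 0 < K ^ 2 * sa ^ 2 := by positivity
    rw [← this] at h3
    exact (pos_iff_pos_of_mul_pos h3).2 hca
  have hG : 0 ≤ K * ((F + cx * cy + K * sx * sy) * (1 + ca) - (cx + cd) * (cy + cf)) := by
    refine nonneg_of_mul_nonneg_right (a := K * (1 - ca)) ?_ hpos
    have : K * (1 - ca) * (K * ((F + cx * cy + K * sx * sy) * (1 + ca) - (cx + cd) * (cy + cf))) =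
      K ^ 2 * ((1 - ca) * ((F + cx * cy) * (1 + ca) - (cx + cd) * (cy + cf)) +
        K * sx * sy * ((1 - ca) * (1 + ca))) := by ring
    rw [this]
    exact mul_nonneg (sq_nonneg K) (by linarith)
  have := mul_nonneg hca.le hb
  linarith

end Algebra

section Cosq

variable {M : Type*} [MetricSpace M] {K : ℝ}

lemma cosq_eq (hK : K ≠ 0) {A P B Q : M} (hx : sn K (dist A P) ≠ 0) (hy : sn K (dist B Q) ≠ 0)
    (ha : 1 + cs K (dist A B) ≠ 0) :
    cosq K A P B Q = ((cs K (dist P Q) + cs K (dist A P) * cs K (dist B Q)) *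
      (1 + cs K (dist A B)) - (cs K (dist A P) + cs K (dist P B)) *
      (cs K (dist B Q) + cs K (dist A Q))) /
      ((1 + cs K (dist A B)) * (K * sn K (dist A P) * sn K (dist B Q))) := by
  unfold cosq
  by_cases h : 0 < K
  · have h1 : √K * √K = K := Real.mul_self_sqrt h.le
    have h2 : √K ≠ 0 := (Real.sqrt_pos.2 h).ne'
    simp only [cs, sn, h, if_true] at hx hy ha ⊢
    have e : K * (Real.sin (√K * dist A P) / √K) * (Real.sin (√K * dist B Q) / √K) =
        Real.sin (√K * dist A P) * Real.sin (√K * dist B Q) := by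
      nth_rewrite 1 [← h1]; field_simp
    have hx' := (div_ne_zero_iff.1 hx).1
    have hy' := (div_ne_zero_iff.1 hy).1
    rw [e]
    field_simp
  · have h' := neg_of_not_pos hK h
    have h0 : 0 < -K := by linarith
    have h1 : √(-K) * √(-K) = -K := Real.mul_self_sqrt h0.le
    have h2 : √(-K) ≠ 0 := (Real.sqrt_pos.2 h0).ne'
    simp only [cs, sn, h, h', if_true, if_false] at hx hy ha ⊢
    have e : K * (Real.sinh (√(-K) * dist A P) / √(-K)) * (Real.sinh (√(-K) * dist B Q) / √(-K)) =
        -(Real.sinh (√(-K) * dist A P) * Real.sinh (√(-K) * dist B Q)) := by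
      have : K = -(√(-K) * √(-K)) := by linarith
      calc _ = -(√(-K) * √(-K)) * (Real.sinh (√(-K) * dist A P) / √(-K)) *
            (Real.sinh (√(-K) * dist B Q) / √(-K)) := by rw [h1, neg_neg]
        _ = _ := by field_simp
    have hx' := (div_ne_zero_iff.1 hx).1
    have hy' := (div_ne_zero_iff.1 hy).1
    rw [e]
    field_simp
    ring

/-- The triangle inequality `XZ ≤ XY + YZ` in terms of cosines. If `K > 0`, it persists for
`XY + YZ > π / √K` because of the bound for the perimeter. -/
lemma IsReDomain.cs_triangle (hM : IsReDomain K M) (hK : K ≠ 0) (X Y Z : M) :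
    0 ≤ K * (cs K (dist X Z) -
      (cs K (dist X Y) * cs K (dist Y Z) - K * sn K (dist X Y) * sn K (dist Y Z))) := by
  rw [← cs_add hK]
  refine cs_perimeter hK dist_nonneg (dist_triangle X Y Z) fun h => ?_
  have := hM.mul_perimeter_lt X Y Z h
  rw [add_right_comm] at this
  exact this.le

/-- The triangle inequality `|XY - YZ| ≤ XZ` in terms of cosines. -/
lemma IsReDomain.cs_triangle' (hM : IsReDomain K M) (hK : K ≠ 0) (X Y Z : M) :
    0 ≤ K * (cs K (dist X Y) * cs K (dist Y Z) +
      K * sn K (dist X Y) * sn K (dist Y Z) - cs K (dist X Z)) := by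
  rw [← cs_sub hK, ← cs_abs]
  have := abs_dist_sub_le X Z Y
  rw [dist_comm Z Y] at this
  exact mul_cs_sub_cs_nonneg hK (abs_nonneg _) this (hM.mul_dist_le_pi X Z)

/-- `cosq ≤ 1`, with the denominators cleared. -/
lemma upper_bound (hK : K ≠ 0) (hM : IsReDomain K M) (A P B Q : M)
    (hc : ∀ X ∈ ({A, P, B, Q} : Set M), ∀ Y ∈ ({A, P, B, Q} : Set M), 0 ≤ cs K (dist X Y)) :
    K * ((cs K (dist P Q) + cs K (dist A P) * cs K (dist B Q) -
      K * sn K (dist A P) * sn K (dist B Q)) * (1 + cs K (dist A B)) -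
      (cs K (dist A P) + cs K (dist P B)) * (cs K (dist B Q) + cs K (dist A Q))) ≤ 0 := by
  have r := hM.mul_dist_le_pi
  have nsn : ∀ X Y : M, 0 ≤ sn K (dist X Y) := fun X Y => sn_nonneg hK dist_nonneg (r X Y)
  have e : ∀ X Y : M, cs K (dist X Y) ^ 2 + K * sn K (dist X Y) ^ 2 = 1 := fun X Y => cs_sq hK _
  have tr := hM.cs_triangle hK
  have tr' := hM.cs_triangle' hK
  have cAP := hc A (by simp) P (by simp)
  have cBQ := hc B (by simp) Q (by simp)
  have cAB := hc A (by simp) B (by simp)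
  have cPQ := hc P (by simp) Q (by simp)
  have cPB := hc P (by simp) B (by simp)
  have cAQ := hc A (by simp) Q (by simp)
  by_cases hAB : A = B
  · subst hAB
    have := tr' P A Q
    rw [dist_comm P A, dist_self, cs_zero] at *
    linarith
  by_cases hPQ : P = Q
  · subst hPQ
    have h1 := tr' A P B
    rw [dist_comm P B, dist_self, cs_zero] at *
    have h2 : 0 ≤ 1 + (cs K (dist A P) * cs K (dist B P) -
        K * sn K (dist A P) * sn K (dist B P)) := by
      rw [← cs_add hK]; linarith [neg_one_le_cs K (dist A P + dist B P)]
    have h3 := mul_nonneg h2 h1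
    have e1 := e A P
    have e2 := e B P
    have : K * ((1 + cs K (dist A P) * cs K (dist B P) - K * sn K (dist A P) * sn K (dist B P)) *
        (1 + cs K (dist A B)) - (cs K (dist A P) + cs K (dist B P)) *
        (cs K (dist B P) + cs K (dist A P))) =
      -((1 + (cs K (dist A P) * cs K (dist B P) - K * sn K (dist A P) * sn K (dist B P))) *
        (K * (cs K (dist A P) * cs K (dist B P) + K * sn K (dist A P) * sn K (dist B P) -
          cs K (dist A B)))) := by
      grind
    rw [this]; linarith
  by_cases hPB : P = B
  · subst hPB
    have h1 := mul_nonneg (by linarith : 0 ≤ 1 + cs K (dist A P)) (tr A P Q)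
    rw [dist_self, cs_zero]
    linarith
  have sAB := hM.sn_dist_pos hK hAB
  have sPQ := hM.sn_dist_pos hK hPQ
  by_cases hE : cs K (dist P Q) + cs K (dist A P) * cs K (dist B Q) -
      K * sn K (dist A P) * sn K (dist B Q) < 0
  · have hKpos : 0 < K := by
      by_contra h
      have := one_le_cs h (dist A P + dist B Q)
      rw [cs_add hK] at this
      linarith
    have h1 := mul_neg_of_neg_of_pos hE (by linarith : 0 < 1 + cs K (dist A B))
    have h2 : 0 ≤ (cs K (dist A P) + cs K (dist P B)) * (cs K (dist B Q) + cs K (dist A Q)) := by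
      positivity
    exact mul_nonpos_of_nonneg_of_nonpos hKpos.le (by linarith)
  push Not at hE
  have h4 := four_points hK hM (Ne.symm hPB) A Q (by rwa [dist_comm]) (by rwa [dist_comm]) cBQ cPQ
  rw [sn_add, sn_add, dist_comm B A, dist_comm P A, dist_comm B P] at h4
  rcases h4 with h4 | h4 | ⟨p, h, q, k, h1, h2, h3, h4, h5⟩
  · refine upper_of_straight_left sAB (nsn _ _) (by linarith) (by linarith) (e A B) h4
      (tr A B Q) ?_
    have := tr' B A P
    rwa [dist_comm B A, dist_comm B P] at this
  · refine upper_of_straight_right sPQ (nsn _ _) (by linarith) (e A P) (e B Q) (e P Q) hE ?_ h4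
      (tr A P Q) ?_
    · rw [← cs_add hK, ← sn_add, ← cs_add hK]
      linarith [neg_one_le_cs K (dist A P + dist P Q + dist B Q)]
    · have := tr' P Q B
      rwa [dist_comm Q B] at this
  · exact upper_of_convex sAB (nsn _ _) (nsn _ _) hK (by linarith) (by linarith) (e A B) (e P B)
      (e A P) h1 h2 h3 h4 h5

/-- `-1 ≤ cosq`, with the denominators cleared. -/
lemma lower_bound (hK : K ≠ 0) (hM : IsReDomain K M) (A P B Q : M)
    (hc : ∀ X ∈ ({A, P, B, Q} : Set M), ∀ Y ∈ ({A, P, B, Q} : Set M), 0 ≤ cs K (dist X Y)) :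
    0 ≤ K * ((cs K (dist P Q) + cs K (dist A P) * cs K (dist B Q) +
      K * sn K (dist A P) * sn K (dist B Q)) * (1 + cs K (dist A B)) -
      (cs K (dist A P) + cs K (dist P B)) * (cs K (dist B Q) + cs K (dist A Q))) := by
  have r := hM.mul_dist_le_pi
  have nsn : ∀ X Y : M, 0 ≤ sn K (dist X Y) := fun X Y => sn_nonneg hK dist_nonneg (r X Y)
  have e : ∀ X Y : M, cs K (dist X Y) ^ 2 + K * sn K (dist X Y) ^ 2 = 1 := fun X Y => cs_sq hK _
  have tr := hM.cs_triangle hK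
  have tr' := hM.cs_triangle' hK
  have cAP := hc A (by simp) P (by simp)
  have cBQ := hc B (by simp) Q (by simp)
  have cAB := hc A (by simp) B (by simp)
  have cPQ := hc P (by simp) Q (by simp)
  have cPB := hc P (by simp) B (by simp)
  have cAQ := hc A (by simp) Q (by simp)
  by_cases hAB : A = B
  · subst hAB
    have := tr P A Q
    rw [dist_comm P A, dist_self, cs_zero] at *
    linarith
  by_cases hAQ : A = Q
  · subst hAQ
    have h1 := mul_nonneg (by linarith : 0 ≤ 1 + cs K (dist A B)) (tr' P A B)
    rw [dist_self, cs_zero, dist_comm B A]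
    rw [dist_comm P A] at *
    linarith
  by_cases hPB : P = B
  · subst hPB
    have h1 := mul_nonneg (by linarith : 0 ≤ 1 + cs K (dist A P)) (tr' A P Q)
    rw [dist_self, cs_zero]
    linarith
  have sAB := hM.sn_dist_pos hK hAB
  have sAQ := hM.sn_dist_pos hK hAQ
  have sPB := hM.sn_dist_pos hK hPB
  have h4 := four_points hK hM (Ne.symm hAB) P Q (by rwa [dist_comm]) cAP cBQ cAQ
  rw [sn_add, sn_add, dist_comm B A, dist_comm B P] at h4
  rcases h4 with h4 | h4 | ⟨p, h, q, k, h1, h2, h3, h4, h5⟩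
  · have := lower_of_straight (cx := cs K (dist B Q)) (cf := cs K (dist P B))
      (cy := cs K (dist A P)) (cd := cs K (dist A Q)) (cb := cs K (dist P Q))
      (ca := cs K (dist A B)) sPB (nsn B Q) (by linarith) (by linarith)
      (e A P) (e P B) ?_ (by linarith) ?_ ?_
    · linarith
    · rw [← cs_add hK]; linarith [neg_one_le_cs K (dist P B + dist A P)]
    · have := tr P B Q; linarith
    · have := tr' A P B; linarith
  · refine lower_of_straight sAQ (nsn A P) (by linarith) (by linarith) (e B Q) (e A Q) ?_ h4 ?_ ?_
    · rw [← cs_add hK]; linarith [neg_one_le_cs K (dist A Q + dist B Q)]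
    · have := tr P A Q
      rwa [dist_comm P A] at this
    · have := tr' A Q B
      rwa [dist_comm Q B] at this
  · exact lower_of_convex sAB (nsn _ _) (nsn _ _) hK (by linarith) (e A B) (e A P) (e P B)
      h1 h2 h3 h4 h5

/-- The quadrilateral cosine is at most `1` in absolute value if the diameter is at most a quarter of
the length of the great circles of the `K`-plane. -/
theorem abs_cosq_le_one (hK : K ≠ 0) (hM : IsReDomain K M) {A P B Q : M} (hAP : A ≠ P)
    (hBQ : B ≠ Q) (hdiam : 0 < K → Metric.diam ({A, P, B, Q} : Set M) ≤ Real.pi / (2 * √K)) :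
    |cosq K A P B Q| ≤ 1 := by
  have hc : ∀ X ∈ ({A, P, B, Q} : Set M), ∀ Y ∈ ({A, P, B, Q} : Set M), 0 ≤ cs K (dist X Y) := by
    intro X hX Y hY
    by_cases h : 0 < K
    · have hk : 0 < √K := Real.sqrt_pos.2 h
      have h1 := (Metric.dist_le_diam_of_mem (Set.toFinite _).isBounded hX hY).trans (hdiam h)
      rw [le_div_iff₀ (by positivity)] at h1
      simp only [cs, h, if_true]
      apply Real.cos_nonneg_of_neg_pi_div_two_le_of_le
      · have : 0 ≤ √K * dist X Y := by positivity
        linarith [Real.pi_pos]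
      · linarith
    · linarith [one_le_cs h (dist X Y)]
  have sx := hM.sn_dist_pos hK hAP
  have sy := hM.sn_dist_pos hK hBQ
  have ca : 0 < 1 + cs K (dist A B) := by linarith [hc A (by simp) B (by simp)]
  have hu := upper_bound hK hM A P B Q hc
  have hl := lower_bound hK hM A P B Q hc
  have hpos : 0 < K ^ 2 * (1 + cs K (dist A B)) * sn K (dist A P) * sn K (dist B Q) := by
    positivity
  rw [cosq_eq hK sx.ne' sy.ne' ca.ne', abs_le]
  set N := (cs K (dist P Q) + cs K (dist A P) * cs K (dist B Q)) *
      (1 + cs K (dist A B)) - (cs K (dist A P) + cs K (dist P B)) *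
      (cs K (dist B Q) + cs K (dist A Q)) with hN
  have e : N / ((1 + cs K (dist A B)) * (K * sn K (dist A P) * sn K (dist B Q))) =
      K * N / (K ^ 2 * (1 + cs K (dist A B)) * sn K (dist A P) * sn K (dist B Q)) := by
    field_simp
  rw [e, le_div_iff₀ hpos, div_le_iff₀ hpos]
  constructor <;> rw [hN] <;> linarith

end Cosq

/-! ### Tree-like spaces -/

section Tree

variable {M : Type*} [MetricSpace M] {K : ℝ}

/-- In a space with the four-point property of metric trees, an upper angle of a triangle is at most
the corresponding angle in the `K`-plane: two shortests from `O` have a common beginning, and their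
angle is zero, unless `O` is between their ends, in which case the angle in the `K`-plane is `π`. -/
lemma upperAngle_le_modelAngle_of_four_points (hK : K ≠ 0)
    (h4 : ∀ u v w t : M, dist u v + dist w t ≤
      max (dist u w + dist v t) (dist u t + dist v w))
    (hr : ∀ u v : M, 0 < K → √K * dist u v < Real.pi) {O X Y : M} {γ η : ℝ → M}
    (hγ : IsShortest γ O X) (hη : IsShortest η O Y) (hX : O ≠ X) (hY : O ≠ Y) :
    upperAngle K γ η ≤ modelAngle K (dist O X) (dist O Y) (dist X Y) := by
  have hx := dist_pos.2 hX
  have hy := dist_pos.2 hY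
  have sx := sn_pos hK hx (hr O X)
  have sy := sn_pos hK hy (hr O Y)
  rcases (dist_triangle_left X Y O).eq_or_lt with h | h
  · rw [h, modelAngle_eq hK _ _ (dist O X + dist O Y), angleCos_add hK sx.ne' sy.ne',
      Real.arccos_neg_one]
    exact upperAngle_le_pi hK _ _
  refine le_trans (upperAngle_le_of_eventually_le hK ?_) (modelAngle_nonneg hK _ _ _)
  set m := (dist O X + dist O Y - dist X Y) / 2 with hm
  have hmpos : 0 < m := by rw [hm]; linarith
  have e1 : ∀ᶠ x : ℝ in 𝓝[>] 0, 0 < x ∧ x < m ∧ x < dist O X := by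
    filter_upwards [self_mem_nhdsWithin, nhdsWithin_le_nhds (eventually_lt_nhds hmpos),
      nhdsWithin_le_nhds (eventually_lt_nhds hx)] with x (h1 : 0 < x) h2 h3 using ⟨h1, h2, h3⟩
  have e2 : ∀ᶠ y : ℝ in 𝓝[>] 0, 0 < y ∧ y < dist O Y := by
    filter_upwards [self_mem_nhdsWithin, nhdsWithin_le_nhds (eventually_lt_nhds hy)]
      with y (h1 : 0 < y) h2 using ⟨h1, h2⟩
  filter_upwards [e1.prod_mk e2] with ⟨x, y⟩ ⟨⟨hx0, hxm, hx1⟩, hy0, hy1⟩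
  simp only at hx0 hxm hx1 hy0 hy1 ⊢
  have a1 := hγ.dist_left ⟨hx0.le, hx1.le⟩
  have a2 := hγ.dist_right ⟨hx0.le, hx1.le⟩
  have b1 := hη.dist_left ⟨hy0.le, hy1.le⟩
  have b2 := hη.dist_right ⟨hy0.le, hy1.le⟩
  have c1 : dist (γ x) Y ≤ dist O Y - x := by
    have := h4 (γ x) Y O X
    rw [dist_comm (γ x) O, a1, a2, dist_comm Y X, dist_comm Y O] at this
    have h5 : max (x + dist X Y) (dist O X - x + dist O Y) ≤ dist O X - x + dist O Y :=
      max_le (by linarith) le_rfl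
    linarith
  have c2 : dist (γ x) (η y) ≤ |x - y| := by
    have := h4 (γ x) (η y) O Y
    rw [dist_comm (γ x) O, a1, b2, dist_comm (η y) O, b1] at this
    have h5 : max (x + (dist O Y - y)) (dist (γ x) Y + y) ≤ dist O Y + |x - y| :=
      max_le (by linarith [le_abs_self (x - y)]) (by linarith [neg_abs_le (x - y)])
    linarith
  have c3 : dist (γ x) (η y) = |x - y| := by
    refine le_antisymm c2 ?_
    have := abs_dist_sub_le (γ x) (η y) O
    rwa [dist_comm _ O, a1, dist_comm _ O, b1] at this
  have hle : ∀ s d : ℝ, s < d → (0 < K → √K * d < Real.pi) → 0 < K → √K * s < Real.pi :=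
    fun s d hs hd h => (mul_le_mul_of_nonneg_left hs.le (Real.sqrt_nonneg _)).trans_lt (hd h)
  have sx' := sn_pos hK hx0 (hle _ _ hx1 (hr O X))
  have sy' := sn_pos hK hy0 (hle _ _ hy1 (hr O Y))
  rw [c3, modelAngle_eq hK, angleCos_sub hK sx'.ne' sy'.ne', Real.arccos_one]

/-- The four-point property follows from its special case in which one of the points is fixed, that
is, from the ultrametric property of the Gromov product at one point `o`. -/
lemma four_points_of_gromov (o : M)
    (h : ∀ p q r : M, min (dist o p + dist o r - dist p r) (dist o r + dist o q - dist r q) ≤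
      dist o p + dist o q - dist p q) (u v w t : M) :
    dist u v + dist w t ≤ max (dist u w + dist v t) (dist u t + dist v w) := by
  have i1 := h u v w
  have i2 := h u v t
  have i3 := h w t u
  have i4 := h w t v
  rw [dist_comm w u] at i3
  rw [dist_comm w v] at i4
  rw [dist_comm w v] at i1
  rw [dist_comm t v] at i2
  rw [le_max_iff]
  rw [min_le_iff] at i1 i2 i3 i4
  by_contra! hc
  obtain ⟨hc1, hc2⟩ := hc
  rcases i1 with i1 | i1 <;> rcases i2 with i2 | i2 <;> rcases i3 with i3 | i3 <;>
    rcases i4 with i4 | i4 <;> linarith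

end Tree

/-! ### The `T`-shaped graph -/

section TGraph

variable {l : ℝ}

lemma TGraph.dist_eq (p q : TGraph l) :
    dist p q = |p.1 0 - q.1 0| + |p.1 1 - q.1 1| := by
  rw [Subtype.dist_eq, PiLp.dist_eq_of_L1, Fin.sum_univ_two, Real.dist_eq, Real.dist_eq]

lemma min_gromov_le (a b c : ℝ) :
    min (|a| + |c| - |a - c|) (|c| + |b| - |c - b|) ≤ |a| + |b| - |a - b| := by
  rw [min_le_iff]
  by_contra! h
  obtain ⟨h1, h2⟩ := h
  rcases abs_cases a with ⟨ha, _⟩ | ⟨ha, _⟩ <;> rcases abs_cases b with ⟨hb, _⟩ | ⟨hb, _⟩ <;>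
  rcases abs_cases c with ⟨hc, _⟩ | ⟨hc, _⟩ <;>
  rcases abs_cases (a - b) with ⟨hab, _⟩ | ⟨hab, _⟩ <;>
  rcases abs_cases (a - c) with ⟨hac, _⟩ | ⟨hac, _⟩ <;>
  rcases abs_cases (c - b) with ⟨hcb, _⟩ | ⟨hcb, _⟩ <;> linarith

/-- The center of the graph. -/
noncomputable def TGraph.center (hl : 0 ≤ l) : TGraph l :=
  ⟨WithLp.toLp 1 ![0, 0], Or.inl ⟨⟨by simpa using hl, by simpa using hl⟩, by simp⟩⟩

lemma TGraph.four_points (hl : 0 ≤ l) (u v w t : TGraph l) :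
    dist u v + dist w t ≤ max (dist u w + dist v t) (dist u t + dist v w) := by
  refine four_points_of_gromov (TGraph.center hl) (fun p q r => ?_) u v w t
  have ho : ∀ p : TGraph l, dist (TGraph.center hl) p = |p.1 0| + |p.1 1| := fun p => by
    rw [TGraph.dist_eq]; simp [TGraph.center]
  rw [ho, ho, ho, TGraph.dist_eq, TGraph.dist_eq, TGraph.dist_eq]
  have a1 := abs_sub (p.1 0) (q.1 0)
  have a2 := abs_sub (p.1 1) (q.1 1)
  rcases p.2 with ⟨-, hp⟩ | ⟨hp, -⟩ <;> rcases q.2 with ⟨-, hq⟩ | ⟨hq, -⟩ <;>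
    rcases r.2 with ⟨-, hr⟩ | ⟨hr, -⟩ <;> rw [hp, hq, hr] at * <;>
    simp only [abs_zero, sub_zero, zero_sub, add_zero, zero_add, abs_neg] at *
  · exact min_gromov_le _ _ _
  · exact min_le_iff.2 (Or.inl (by linarith))
  · exact min_le_iff.2 (Or.inr (by linarith))
  · exact min_le_iff.2 (Or.inl (by linarith))
  · exact min_le_iff.2 (Or.inl (by linarith))
  · exact min_le_iff.2 (Or.inr (by linarith))
  · exact min_le_iff.2 (Or.inl (by linarith))
  · exact min_gromov_le _ _ _

lemma TGraph.exists_shortest_of_coordinates {P Q : TGraph l} (x y : ℝ → ℝ)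
    (hmem : ∀ t ∈ Icc 0 (dist P Q), WithLp.toLp 1 ![x t, y t] ∈ TGraph l)
    (hx0 : x 0 = P.1 0) (hy0 : y 0 = P.1 1) (hx1 : x (dist P Q) = Q.1 0)
    (hy1 : y (dist P Q) = Q.1 1)
    (hiso : ∀ s ∈ Icc 0 (dist P Q), ∀ t ∈ Icc 0 (dist P Q), |x s - x t| + |y s - y t| = |s - t|) :
    ∃ γ, IsShortest γ P Q := by
  classical
  have key : ∀ t, t ∈ Icc 0 (dist P Q) → ∀ R : TGraph l, x t = R.1 0 → y t = R.1 1 →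
      ∀ h : WithLp.toLp 1 ![x t, y t] ∈ TGraph l, (⟨_, h⟩ : TGraph l) = R := by
    intro t _ R h1 h2 h
    apply Subtype.ext
    ext i
    fin_cases i
    · simpa using h1
    · simpa using h2
  refine ⟨fun t => if h : WithLp.toLp 1 ![x t, y t] ∈ TGraph l then ⟨_, h⟩ else P, ?_, ?_, ?_⟩
  · have h := hmem 0 ⟨le_rfl, dist_nonneg⟩
    simp only [h, dif_pos]
    exact key _ ⟨le_rfl, dist_nonneg⟩ _ hx0 hy0 h
  · have h := hmem _ ⟨dist_nonneg, le_rfl⟩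
    simp only [h, dif_pos]
    exact key _ ⟨dist_nonneg, le_rfl⟩ _ hx1 hy1 h
  · intro s hs t ht
    simp only [hmem s hs, hmem t ht, dif_pos]
    rw [TGraph.dist_eq, ← hiso s hs t ht]
    simp

/-- The coordinate of the shortest between two points of a line. -/
lemma exists_unit_speed (p q : ℝ) : ∃ x : ℝ → ℝ, x 0 = p ∧ x |p - q| = q ∧
    (∀ s t, |x s - x t| = |s - t|) ∧
    ∀ t ∈ Icc 0 |p - q|, min p q ≤ x t ∧ x t ≤ max p q := by
  rcases le_total p q with h | h
  · refine ⟨fun t => p + t, by simp, by rw [abs_of_nonpos (by linarith)]; ring,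
      fun s t => by congr 1; ring, fun t ht => ?_⟩
    rw [abs_of_nonpos (by linarith)] at ht
    rw [min_eq_left h, max_eq_right h]
    exact ⟨by linarith [ht.1], by linarith [ht.2]⟩
  · refine ⟨fun t => p - t, by simp, by rw [abs_of_nonneg (by linarith)]; ring,
      fun s t => by rw [abs_sub_comm s t]; congr 1; ring, fun t ht => ?_⟩
    rw [abs_of_nonneg (by linarith)] at ht
    rw [min_eq_right h, max_eq_left h]
    exact ⟨by linarith [ht.2], by linarith [ht.1]⟩

lemma abs_max_sub_add (a s t : ℝ) :
    |max (a - s) 0 - max (a - t) 0| + |max (s - a) 0 - max (t - a) 0| = |s - t| := by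
  grind

/-- A shortest from the crossbar to the stem runs along the crossbar to the center first. -/
lemma TGraph.exists_shortest_cross {P Q : TGraph l} (hP : P.1 0 ∈ Icc (-l) l) (hP' : P.1 1 = 0)
    (hQ : Q.1 0 = 0) (hQ' : Q.1 1 ∈ Icc 0 l) : ∃ γ, IsShortest γ P Q := by
  have hd : dist P Q = |P.1 0| + Q.1 1 := by
    rw [TGraph.dist_eq, hP', hQ, sub_zero, zero_sub, abs_neg, abs_of_nonneg hQ'.1]
  set p := P.1 0
  set q := Q.1 1
  have hp : |p| ≤ l := abs_le.2 hP
  obtain ⟨σ, hσ, hσp⟩ : ∃ σ : ℝ, |σ| = 1 ∧ σ * |p| = p := by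
    rcases abs_cases p with ⟨h, _⟩ | ⟨h, _⟩
    · exact ⟨1, by simp, by rw [h]; ring⟩
    · exact ⟨-1, by simp, by rw [h]; ring⟩
  refine TGraph.exists_shortest_of_coordinates (fun t => σ * max (|p| - t) 0)
    (fun t => max (t - |p|) 0) ?_ ?_ ?_ ?_ ?_ ?_
  · intro t ht
    rw [hd] at ht
    rcases le_total t |p| with h | h
    · left
      have h1 : |σ * max (|p| - t) 0| ≤ l := by
        rw [abs_mul, hσ, one_mul, max_eq_left (by linarith), abs_of_nonneg (by linarith)]
        linarith [ht.1]
      exact ⟨by simpa using abs_le.1 h1, by simpa using h⟩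
    · right
      refine ⟨by simpa using Or.inr h, ?_⟩
      simp only [Matrix.cons_val_one, Matrix.cons_val_zero]
      rw [max_eq_left (by linarith)]
      exact ⟨by linarith, by linarith [ht.2, hQ'.2]⟩
  · simp only [sub_zero]
    rw [max_eq_left (abs_nonneg p)]; exact hσp
  · simp [hP']
  · rw [hd, hQ, max_eq_right (by linarith [hQ'.1]), mul_zero]
  · rw [hd, max_eq_left (by linarith [hQ'.1])]; ring
  · intro s _ t _
    rw [← mul_sub, abs_mul, hσ, one_mul]
    exact abs_max_sub_add _ _ _

lemma TGraph.exists_shortest (P Q : TGraph l) : ∃ γ, IsShortest γ P Q := by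
  rcases P.2 with ⟨hP, hP'⟩ | ⟨hP, hP'⟩ <;> rcases Q.2 with ⟨hQ, hQ'⟩ | ⟨hQ, hQ'⟩
  · obtain ⟨x, h0, h1, h2, h3⟩ := exists_unit_speed (P.1 0) (Q.1 0)
    have hd : dist P Q = |P.1 0 - Q.1 0| := by rw [TGraph.dist_eq, hP', hQ']; simp
    rw [← hd] at h1 h3
    refine TGraph.exists_shortest_of_coordinates x (fun _ => 0) (fun t ht => ?_) h0 hP'.symm h1
      hQ'.symm (fun s _ t _ => by simp [h2])
    exact Or.inl ⟨⟨(le_min hP.1 hQ.1).trans (h3 t ht).1, (h3 t ht).2.trans (max_le hP.2 hQ.2)⟩, rfl⟩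
  · exact TGraph.exists_shortest_cross hP hP' hQ hQ'
  · obtain ⟨γ, hγ⟩ := TGraph.exists_shortest_cross hQ hQ' hP hP'
    exact ⟨_, hγ.reverse⟩
  · obtain ⟨x, h0, h1, h2, h3⟩ := exists_unit_speed (P.1 1) (Q.1 1)
    have hd : dist P Q = |P.1 1 - Q.1 1| := by rw [TGraph.dist_eq, hP, hQ]; simp
    rw [← hd] at h1 h3
    refine TGraph.exists_shortest_of_coordinates (fun _ => 0) x (fun t ht => ?_) hP.symm h0 hQ.symm
      h1 (fun s _ t _ => by simp [h2])
    exact Or.inr ⟨rfl, (le_min hP'.1 hQ'.1).trans (h3 t ht).1, (h3 t ht).2.trans (max_le hP'.2 hQ'.2)⟩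

lemma TGraph.dist_le (p q : TGraph l) : dist p q ≤ 2 * l := by
  rw [TGraph.dist_eq]
  have h1 := abs_sub (p.1 0) (q.1 0)
  have h2 := abs_sub (p.1 1) (q.1 1)
  have hb : ∀ p : TGraph l, |p.1 0| + |p.1 1| ≤ l := by
    intro p
    rcases p.2 with ⟨h, h'⟩ | ⟨h, h'⟩
    · rw [h', abs_zero, add_zero]; exact abs_le.2 h
    · rw [h, abs_zero, zero_add, abs_of_nonneg h'.1]; exact h'.2
  linarith [hb p, hb q]

/-- Triangles of the graph are tripods or segments, of perimeter at most `6 * l`. -/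
theorem TGraph.isReDomain {K : ℝ} (hK : 0 < K) (hl : 0 ≤ l) (h : √K * (6 * l) < 2 * Real.pi) :
    IsReDomain K (TGraph l) where
  geodesic := TGraph.exists_shortest
  perimeter_lt := by
    intro _ T
    have hk : 0 < √K := Real.sqrt_pos.2 hK
    rw [lt_div_iff₀ hk]
    have h1 : T.perimeter ≤ 6 * l := by
      have a1 := TGraph.dist_le T.A T.B
      have a2 := TGraph.dist_le T.B T.C
      have a3 := TGraph.dist_le T.C T.A
      rw [GeodesicTriangle.perimeter]; linarith
    nlinarith [mul_le_mul_of_nonneg_left h1 hk.le]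
  excess_nonpos := by
    intro T
    have hk : 0 < √K := Real.sqrt_pos.2 hK
    have hr : ∀ u v : TGraph l, 0 < K → √K * dist u v < Real.pi := fun u v _ => by
      have := mul_le_mul_of_nonneg_left (TGraph.dist_le u v) hk.le
      linarith [mul_nonneg hk.le hl, Real.pi_pos]
    have h4 := TGraph.four_points hl
    have A := upperAngle_le_modelAngle_of_four_points hK.ne' h4 hr T.shortest_AB
      T.shortest_CA.reverse T.ne_AB T.ne_CA.symm
    have B := upperAngle_le_modelAngle_of_four_points hK.ne' h4 hr T.shortest_BC
      T.shortest_AB.reverse T.ne_BC T.ne_AB.symm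
    have C := upperAngle_le_modelAngle_of_four_points hK.ne' h4 hr T.shortest_CA
      T.shortest_BC.reverse T.ne_CA T.ne_BC.symm
    rw [dist_comm T.A T.C] at A
    rw [dist_comm T.B T.A] at B
    rw [dist_comm T.C T.B] at C
    rw [GeodesicTriangle.excess, GeodesicTriangle.upperAngleSum, GeodesicTriangle.modelAngleSum]
    linarith

end TGraph

/-! ### Sharpness of the diameter bound -/

section Sharpness

variable {ε : ℝ}

lemma sin_cos_bounds (h0 : 0 < ε) (h1 : ε < Real.pi / 12) :
    0 < Real.sin ε ∧ Real.sin ε < 1 ∧ 0 < Real.cos ε ∧ Real.cos ε < 1 ∧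
      0 < Real.sin (2 * ε) ∧ Real.sin (2 * ε) < 1 ∧ 0 < Real.cos (2 * ε) ∧
      Real.cos (2 * ε) < Real.cos ε := by
  have hpi := Real.pi_pos
  have hlt : ∀ u, 0 < u → u < Real.pi / 2 → Real.sin u < 1 ∧ Real.cos u < 1 := fun u hu hu' => by
    constructor
    · rw [← Real.sin_pi_div_two]
      exact Real.sin_lt_sin_of_lt_of_le_pi_div_two (by linarith) le_rfl hu'
    · rw [← Real.cos_zero]
      exact Real.cos_lt_cos_of_nonneg_of_le_pi le_rfl (by linarith) hu
  exact ⟨Real.sin_pos_of_pos_of_lt_pi h0 (by linarith), (hlt ε h0 (by linarith)).1,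
    Real.cos_pos_of_mem_Ioo ⟨by linarith, by linarith⟩, (hlt ε h0 (by linarith)).2,
    Real.sin_pos_of_pos_of_lt_pi (by linarith) (by linarith),
    (hlt (2 * ε) (by linarith) (by linarith)).1,
    Real.cos_pos_of_mem_Ioo ⟨by linarith, by linarith⟩,
    Real.cos_lt_cos_of_nonneg_of_le_pi h0.le (by linarith) (by linarith)⟩

/-- The value of `cosq` on the two arms of the crossbar and the end of the stem, directed to the
center. -/
lemma cosq_value_toward (h0 : 0 < ε) (h1 : ε < Real.pi / 12) :
    (-Real.sin ε + -Real.sin (2 * ε) * Real.cos ε) / (Real.cos (2 * ε) * Real.sin ε) -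
      (-Real.sin (2 * ε) + -Real.sin (2 * ε)) * (Real.cos ε + -Real.sin ε) /
        ((1 + -Real.sin (2 * ε)) * Real.cos (2 * ε) * Real.sin ε) =
    (1 + Real.sin (2 * ε)) / (1 - Real.sin (2 * ε)) := by
  obtain ⟨hs, -, hc, -, -, h2s, h2c, -⟩ := sin_cos_bounds h0 h1
  have e := Real.sin_sq_add_cos_sq ε
  have e1 : (1 + -Real.sin (2 * ε)) ≠ 0 := by linarith
  have e2 : (1 - Real.sin (2 * ε)) ≠ 0 := by linarith
  rw [div_sub_div _ _ (by positivity) (by positivity), div_eq_div_iff (by positivity) e2]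
  have hc2 : Real.cos (2 * ε) = Real.cos ε ^ 2 - Real.sin ε ^ 2 := Real.cos_two_mul' ε
  have key : (-Real.sin ε + -Real.sin (2 * ε) * Real.cos ε) * (1 + -Real.sin (2 * ε)) -
      (-Real.sin (2 * ε) + -Real.sin (2 * ε)) * (Real.cos ε + -Real.sin ε) =
      (1 + Real.sin (2 * ε)) * Real.cos (2 * ε) * Real.sin ε := by
    rw [hc2, Real.sin_two_mul]
    grind
  linear_combination (Real.cos (2 * ε) * Real.sin ε * (1 - Real.sin (2 * ε))) * key

/-- The value of `cosq` if the vector at the end of the stem is directed away from the center. -/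
lemma cosq_value_away (h0 : 0 < ε) (h1 : ε < Real.pi / 12) :
    (-Real.sin (2 * ε) + -Real.sin (2 * ε) * Real.cos ε) / (Real.cos (2 * ε) * Real.sin ε) -
      (-Real.sin (2 * ε) + -Real.sin ε) * (Real.cos ε + -Real.sin (2 * ε)) /
        ((1 + -Real.sin ε) * Real.cos (2 * ε) * Real.sin ε) =
    -((1 + Real.sin (2 * ε)) * Real.cos ε) / ((1 - Real.sin ε) * Real.cos (2 * ε)) := by
  obtain ⟨hs, hs1, hc, -, -, -, h2c, -⟩ := sin_cos_bounds h0 h1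
  have e1 : (1 + -Real.sin ε) ≠ 0 := by linarith
  have e2 : (1 - Real.sin ε) ≠ 0 := by linarith
  rw [div_sub_div _ _ (by positivity) (by positivity), div_eq_div_iff (by positivity)
    (by positivity)]
  have key : (-Real.sin (2 * ε) + -Real.sin (2 * ε) * Real.cos ε) * (1 + -Real.sin ε) -
      (-Real.sin (2 * ε) + -Real.sin ε) * (Real.cos ε + -Real.sin (2 * ε)) =
      -((1 + Real.sin (2 * ε)) * Real.cos ε) * Real.sin ε := by
    rw [Real.sin_two_mul]; ring
  linear_combination (Real.cos (2 * ε) ^ 2 * Real.sin ε * (1 - Real.sin ε)) * key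

end Sharpness

theorem mainTheorem3 :
    (∀ (K : ℝ), K ≠ 0 → ∀ (M : Type*) [MetricSpace M], IsReDomain K M →
      ∀ A P B Q : M, A ≠ P → B ≠ Q →
        (0 < K → Metric.diam ({A, P, B, Q} : Set M) ≤ Real.pi / (2 * √K)) →
          |cosq K A P B Q| ≤ 1) ∧
    (∀ (K : ℝ), 0 < K → ∀ (ε : ℝ), 0 < ε → ε < Real.pi / 12 →
      ∀ (l : ℝ), l = (Real.pi / 4 + ε) / √K →
        IsReDomain K (TGraph l) ∧
        Metric.diam (Set.univ : Set (TGraph l)) = (Real.pi / 2 + 2 * ε) / √K ∧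
        ∃ A P B Q : TGraph l,
          A.1 = WithLp.toLp 1 ![0, l] ∧ P.1 = WithLp.toLp 1 ![0, l - ε / √K] ∧
          B.1 = WithLp.toLp 1 ![-l, 0] ∧ Q.1 = WithLp.toLp 1 ![l, 0] ∧
          B ≠ Q ∧ A ≠ P ∧
          cosq K B Q A P = (1 + Real.sin (2 * ε)) / (1 - Real.sin (2 * ε)) ∧
          1 < cosq K B Q A P ∧
          cosq K B Q P A = -((1 + Real.sin (2 * ε)) * Real.cos ε) /
            ((1 - Real.sin ε) * Real.cos (2 * ε)) ∧
          cosq K B Q P A < -1) := by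
  refine ⟨fun K hK M _ hM A P B Q hAP hBQ hdiam => abs_cosq_le_one hK hM hAP hBQ hdiam, ?_⟩
  intro K hK ε h0 h1 l hl
  have hk : 0 < √K := Real.sqrt_pos.2 hK
  have hpi := Real.pi_pos
  have hlpos : 0 < l := by rw [hl]; positivity
  have hkl : √K * l = Real.pi / 4 + ε := by rw [hl]; field_simp
  have hεl : ε / √K < l := by
    rw [hl]; exact div_lt_div_of_pos_right (by linarith) hk
  have hεk : 0 < ε / √K := div_pos h0 hk
  obtain ⟨A, hA⟩ : ∃ A : TGraph l, A.1 = WithLp.toLp 1 ![0, l] :=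
    ⟨⟨_, Or.inr ⟨by simp, by simpa using hlpos.le⟩⟩, rfl⟩
  obtain ⟨P, hP⟩ : ∃ P : TGraph l, P.1 = WithLp.toLp 1 ![0, l - ε / √K] :=
    ⟨⟨_, Or.inr ⟨by simp, by simpa using ⟨hεl.le, hεk.le⟩⟩⟩, rfl⟩
  obtain ⟨B, hB⟩ : ∃ B : TGraph l, B.1 = WithLp.toLp 1 ![-l, 0] :=
    ⟨⟨_, Or.inl ⟨by simpa using hlpos.le, by simp⟩⟩, rfl⟩
  obtain ⟨Q, hQ⟩ : ∃ Q : TGraph l, Q.1 = WithLp.toLp 1 ![l, 0] :=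
    ⟨⟨_, Or.inl ⟨by simpa using hlpos.le, by simp⟩⟩, rfl⟩
  have dBQ : dist B Q = 2 * l := by
    rw [TGraph.dist_eq, hB, hQ]
    simp only [Matrix.cons_val_zero, Matrix.cons_val_one]
    rw [abs_of_neg (by linarith)]; simp; ring
  have dAP : dist A P = ε / √K := by
    rw [TGraph.dist_eq, hA, hP]; simp [abs_of_pos hεk]
  have dBA : dist B A = 2 * l := by
    rw [TGraph.dist_eq, hB, hA]; simp [abs_of_pos hlpos]; ring
  have dQA : dist Q A = 2 * l := by
    rw [TGraph.dist_eq, hQ, hA]; simp [abs_of_pos hlpos]; ring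
  have hPpos : 0 < l - ε / √K := by linarith
  have dQP : dist Q P = 2 * l - ε / √K := by
    rw [TGraph.dist_eq, hQ, hP]
    simp only [Matrix.cons_val_zero, Matrix.cons_val_one]
    rw [sub_zero, zero_sub, abs_neg, abs_of_pos hlpos, abs_of_pos hPpos]; ring
  have dBP : dist B P = 2 * l - ε / √K := by
    rw [TGraph.dist_eq, hB, hP]
    simp only [Matrix.cons_val_zero, Matrix.cons_val_one]
    rw [sub_zero, zero_sub, abs_neg, abs_neg, abs_of_pos hlpos, abs_of_pos hPpos]; ring
  have k1 : √K * (2 * l) = 2 * ε + Real.pi / 2 := by linarith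
  have k2 : √K * (ε / √K) = ε := by field_simp
  have k3 : √K * (2 * l - ε / √K) = ε + Real.pi / 2 := by rw [mul_sub, k1, k2]; ring
  obtain ⟨s1, s2, c1, c2, s3, s4, c3, c4⟩ := sin_cos_bounds h0 h1
  have v1 : cosq K B Q A P = (1 + Real.sin (2 * ε)) / (1 - Real.sin (2 * ε)) := by
    simp only [cosq, hK, if_true]
    rw [dBQ, dAP, dBA, dQP, dQA, dBP, k1, k2, k3, Real.cos_add_pi_div_two, Real.cos_add_pi_div_two,
      Real.sin_add_pi_div_two]
    exact cosq_value_toward h0 h1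
  have v2 : cosq K B Q P A = -((1 + Real.sin (2 * ε)) * Real.cos ε) /
      ((1 - Real.sin ε) * Real.cos (2 * ε)) := by
    simp only [cosq, hK, if_true]
    rw [dBQ, dist_comm P A, dAP, dBP, dQA, dQP, dBA, k1, k2, k3, Real.cos_add_pi_div_two,
      Real.cos_add_pi_div_two, Real.sin_add_pi_div_two]
    exact cosq_value_away h0 h1
  refine ⟨TGraph.isReDomain hK hlpos.le ?_, ?_, A, P, B, Q, hA, hP, hB, hQ, ?_, ?_, v1, ?_, v2, ?_⟩
  · have : √K * (6 * l) = 6 * (√K * l) := by ring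
    rw [this, hkl]; linarith
  · have h2l : (Real.pi / 2 + 2 * ε) / √K = 2 * l := by rw [hl]; field_simp; ring
    rw [h2l]
    apply le_antisymm
    · exact Metric.diam_le_of_forall_dist_le (by linarith) fun x _ y _ => TGraph.dist_le x y
    · rw [← dBQ]
      exact Metric.dist_le_diam_of_mem (Metric.isBounded_iff.2
        ⟨2 * l, fun x _ y _ => TGraph.dist_le x y⟩) (mem_univ _) (mem_univ _)
  · exact dist_pos.1 (by rw [dBQ]; linarith)
  · exact dist_pos.1 (by rw [dAP]; exact hεk)
  · rw [v1, lt_div_iff₀ (by linarith)]; linarith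
  · rw [v2, div_lt_iff₀ (mul_pos (by linarith) c3)]
    nlinarith [mul_pos s1 c3, mul_pos s3 c1]
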